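/- All homomorphisms between profinite groups are continuous, and finite groups are discrete. A subset $X$ of a profinite group $\Pi$ converges to $1$ if every open normal subgroup of $\Pi$ contains all but finitely many elements of $X$; the rank of $\Pi$ is the least cardinality of a subset of $\Pi$ that converges to $1$ and generates a dense subgroup. Let $M(\Pi)$ denote the intersection of all maximal normal subgroups of $\Pi$ (the maximal elements among the proper closed normal subgroups). An embedding problem for $\Pi$ is a pair of surjections of profinite groups $\phi\colon\Pi\twoheadrightarrow G$, $\alpha\colon\Gamma\twoheadrightarrow G$; put $H=\ker\alpha$. It is finite if $\Gamma$ is finite, nontrivial if $H\neq 1$, and split if $\alpha$ has a right inverse homomorphism. A weak solution is a homomorphism $\psi\colon\Pi\to\Gamma$ with $\alpha\circ\psi=\phi$; a proper solution is a surjective weak solution. $\Pi$ is projective if every embedding problem for $\Pi$ has a weak solution. A profinite group $\Pi$ of rank $m$ is homogeneous if every embedding problem for $\Pi$ with $\operatorname{rank}(\Gamma)\le m$, $\operatorname{rank}(G)<m$, and $H$ a finite minimal normal subgroup of $\Gamma$ contained in $M(\Gamma)$ has a proper solution. For a finite simple group $S$, let $R_S(\Pi)$ be the largest cardinal $c$ such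 that $\Pi$ surjects onto the product of $c$ copies of $S$. The free profinite group of rank $m$ is the inverse limit of the finite quotients $F_I/K$, where $F_I$ is the abstract free group on a set $I$ of cardinality $m$ and $K$ runs over the normal subgroups of finite index of $F_I$ that contain all but finitely many elements of $I$. **Theorem.** Let $\Pi$ be a projective profinite group of infinite rank $m$. Suppose that every nontrivial finite split embedding problem for $\Pi$ whose kernel $H$ is a minimal normal subgroup of $\Gamma$ contained in $M(\Gamma)$ has (at least) $m$ proper solutions. Then $\Pi$ is homogeneous. If moreover $R_S(\Pi)=m$ for every finite simple group $S$, then $\Pi$ is isomorphic to the free profinite group of rank $m$. -/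

import Mathlib

open CategoryTheory

universe u

namespace HomogeneousProfinite

/-! ### Rank -/

/-- `X` generates the topological group `A`: the smallest closed subgroup of `A` containing `X`
is `A` itself. -/
def TopologicallyGenerates (A : ProfiniteGrp.{u}) (X : Set A) : Prop :=
  (Subgroup.closure X).topologicalClosure = ⊤

/-- `X` converges to `1`: every open normal subgroup contains all but finitely many elements
of `X`. -/
def ConvergesToOne (A : ProfiniteGrp.{u}) (X : Set A) : Prop :=
  ∀ U : OpenNormalSubgroup A, {x ∈ X | x ∉ U}.Finite

/-- The rank of a profinite group: the least cardinality of a generating set converging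
to `1`. (Every profinite group has such a generating set.) -/
noncomputable def rank (A : ProfiniteGrp.{u}) : Cardinal.{u} :=
  sInf {c | ∃ X : Set A, TopologicallyGenerates A X ∧ ConvergesToOne A X ∧ Cardinal.mk X = c}

/-! ### The subgroup `M(A)` and minimal normal subgroups -/

/-- `N` is a maximal normal subgroup of the profinite group `A`: maximal among the proper closed
normal subgroups. -/
def IsMaximalNormal (A : ProfiniteGrp.{u}) (N : Subgroup A) : Prop :=
  Maximal (fun K : Subgroup A => K.Normal ∧ IsClosed (K : Set A) ∧ K ≠ ⊤) N

/-- `M(A)`: the intersection of all maximal normal subgroups of `A`. -/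
def normalRadical (A : ProfiniteGrp.{u}) : Subgroup A :=
  sInf {N | IsMaximalNormal A N}

/-- `H` is a minimal normal subgroup of `A`: minimal among the nontrivial normal subgroups. -/
def IsMinimalNormal {A : Type u} [Group A] (H : Subgroup A) : Prop :=
  Minimal (fun K : Subgroup A => K.Normal ∧ K ≠ ⊥) H

/-! ### Embedding problems -/

/-- An embedding problem for `A`: continuous surjections `φ : A → G` and `α : Γ → G` of
profinite groups. -/
structure EmbeddingProblem (A : ProfiniteGrp.{u}) where
  Γ : ProfiniteGrp.{u}
  G : ProfiniteGrp.{u}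
  φ : A →ₜ* G
  α : Γ →ₜ* G
  φ_surjective : Function.Surjective φ
  α_surjective : Function.Surjective α

namespace EmbeddingProblem

variable {A : ProfiniteGrp.{u}} (E : EmbeddingProblem A)

/-- The kernel `H` of the embedding problem. -/
def kernel : Subgroup E.Γ := E.α.toMonoidHom.ker

/-- The embedding problem is finite. -/
def IsFinite : Prop := Finite E.Γ

/-- The embedding problem is nontrivial: its kernel is nontrivial. -/
def IsNontrivial : Prop := E.kernel ≠ ⊥

/-- The embedding problem is split: `α` has a right inverse homomorphism. -/
def IsSplit : Prop := ∃ s : E.G →ₜ* E.Γ, ∀ g, E.α (s g) = g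

/-- The weak solutions of the embedding problem. -/
def weakSolutions : Set (A →ₜ* E.Γ) := {ψ | ∀ x, E.α (ψ x) = E.φ x}

/-- The proper solutions of the embedding problem. -/
def properSolutions : Set (A →ₜ* E.Γ) := {ψ | ψ ∈ E.weakSolutions ∧ Function.Surjective ψ}

end EmbeddingProblem

/-- A profinite group is projective if each of its embedding problems has a weak solution. -/
def IsProjective (A : ProfiniteGrp.{u}) : Prop :=
  ∀ E : EmbeddingProblem A, E.weakSolutions.Nonempty

/-- A profinite group `A` of rank `m` is homogeneous if every embedding problem for `A` given by
`Γ → G` with `rank Γ ≤ m`, `rank G < m`, whose kernel is a finite minimal normal subgroup of `Γ`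
contained in `M(Γ)`, has a proper solution. -/
def IsHomogeneous (A : ProfiniteGrp.{u}) : Prop :=
  ∀ E : EmbeddingProblem A, rank E.Γ ≤ rank A → rank E.G < rank A →
    Finite E.kernel → IsMinimalNormal E.kernel → E.kernel ≤ normalRadical E.Γ →
    E.properSolutions.Nonempty

/-! ### The invariants `R_S` -/

/-- `R_S(A)`: the largest cardinal `c` such that `A` has a continuous surjection onto the product
of `c` copies of the (discrete) group `S`. For nontrivial `S` these cardinals are bounded by the
cardinality of `A`. -/
noncomputable def simpleRank (S : Type u) [Group S] [TopologicalSpace S] (A : ProfiniteGrp.{u}) :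
    Cardinal.{u} :=
  sSup {c | ∃ (ι : Type u) (f : A →ₜ* (ι → S)), Function.Surjective f ∧ Cardinal.mk ι = c}

/-! ### Free profinite groups -/

/-- The normal subgroups `K` of finite index of the abstract free group on `I` which contain all
but finitely many elements of the basis `I`, ordered by inclusion. -/
abbrev CofiniteNormalSubgroup (I : Type u) : Type u :=
  {K : FiniteIndexNormalSubgroup (FreeGroup I) // {i : I | FreeGroup.of i ∉ K}.Finite}

/-- The inverse system of the finite quotients of the free group on `I` by these subgroups. -/
def freeDiagram (I : Type u) : CofiniteNormalSubgroup I ⥤ FiniteGrp.{u} where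
  obj K := FiniteGrp.of (FreeGroup I ⧸ K.1.toSubgroup)
  map f := FiniteGrp.ofHom (QuotientGroup.map _ _ (MonoidHom.id _) f.le)
  map_id K := by ext ⟨x⟩; rfl
  map_comp f g := by ext ⟨x⟩; rfl

/-- The free profinite group on `I` (as a set converging to `1`): the inverse limit of this
system of finite discrete groups. -/
def freeProfinite (I : Type u) : ProfiniteGrp.{u} :=
  ProfiniteGrp.limit (freeDiagram I ⋙ forget₂ FiniteGrp ProfiniteGrp)

/-- `A` is a free profinite group of rank `m`. -/
def IsFreeOfRank (A : ProfiniteGrp.{u}) (m : Cardinal.{u}) : Prop :=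
  ∃ I : Type u, Cardinal.mk I = m ∧ Nonempty (A ≃ₜ* freeProfinite I)

end HomogeneousProfinite

open HomogeneousProfinite

/-!
The group `A` is compared with a profinite group `B` by means of *correspondences*: closed subgroups
`R` of `A × B` which project onto both factors. By Goursat's lemma such an `R` is an isomorphism
between `A / K` and `B / L`, where `K` and `L` are the left and right kernels of `R`. The fibre
product of an embedding problem is a correspondence, and a correspondence with trivial right kernel
is the graph of a surjection `A → B`. All steps are refinements `{(a, b) ∈ R | f a = g b}` for
homomorphisms `f`, `g` to one finite group (`IsCorrespondence.inf_eqLocus`), so that only finite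
embedding problems ever have to be solved.

*The embedding step.* Let `U` be open and normal in `B` and let `L` be minimal normal over `L ⊓ U`.
To replace `L` by `L ⊓ U`, one has to lift `A → B / UL` to `B / U` by a homomorphism which does not
kill `K` (`IsCorrespondence.refine_of_minimal`). Projectivity gives a weak solution `ψ₀`, and `B / U`
is a quotient of the split extension of `ψ₀(A)` by `UL / U`
(`exists_proper_solution_notMem`). If the kernel of that extension lies in its radical, there are
`m` proper solutions, but fewer than `m` of them kill `K`, since `A / K` is small. Otherwise
`UL / U` is either central, in which case any weak solution serves unless it kills `K`, or a direct
factor of `B / U`. What remains in both cases is an open normal subgroup `C` of `B` which is a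
complement of `L` modulo `L ⊓ U`.

*Homogeneity.* For an embedding problem whose kernel `H` is contained in `M(Γ)` there is no such
complement, because it would be a maximal normal subgroup not containing `H`. The smallness of `K`
holds since a group of rank less than `m` has fewer than `m` homomorphisms to a given finite group
(`mk_hom_le_mk_finset`).

*Freeness.* A complement `C` makes `B / C` a simple group `S`, and `R_S(A) = m` provides a
surjection `A → S` not killing `K` (`exists_surjective_not_le_ker`). Hence for every `B` the right
kernel of a correspondence can be pushed into any given open normal subgroup of `B`
(`exists_refinement_rightKernel_le`), as long as `K` is an intersection of fewer than `m` open
normal subgroups. If `B` is free of rank `m`, the left kernel can be pushed into any open normal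
subgroup of `A` by prescribing the values on a basis (`exists_refinement_leftKernel_le`). Since both
groups have at most `m` open normal subgroups, a transfinite back-and-forth of length at most `m`,
taking intersections at limit stages, ends with a correspondence both of whose kernels are trivial,
that is, an isomorphism (`nonempty_continuousMulEquiv`).
-/

open Cardinal

namespace HomogeneousProfinite

/-! ### Finite embedding problems -/

section OpenKernel

variable {A : Type*} [Group A] [TopologicalSpace A]

theorem continuous_of_isOpen_ker [IsTopologicalGroup A] {P : Type*} [Group P] [TopologicalSpace P]
    [IsTopologicalGroup P] (ψ : A →* P) (h : IsOpen (ψ.ker : Set A)) :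
    Continuous ψ := by
  refine continuous_of_continuousAt_one ψ ?_
  have : (fun _ : A => (1 : P)) =ᶠ[nhds 1] ψ := by
    filter_upwards [h.mem_nhds (one_mem ψ.ker)] with x hx using hx.symm
  exact (continuousAt_const (y := (1 : P))).congr this

theorem isOpen_ker_of_continuous {P : Type*} [Group P] [TopologicalSpace P]
    [DiscreteTopology P] (ψ : A →* P) (h : Continuous ψ) : IsOpen (ψ.ker : Set A) :=
  (isOpen_discrete ({1} : Set P)).preimage h

theorem isOpen_ker_comp {P Q : Type*} [Group P] [Group Q] [IsTopologicalGroup A] (ψ : A →* P)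
    (β : P →* Q) (h : IsOpen (ψ.ker : Set A)) : IsOpen ((β.comp ψ).ker : Set A) :=
  Subgroup.isOpen_mono (fun x hx => by
    rw [MonoidHom.mem_ker] at hx ⊢; simp [hx]) h

end OpenKernel

/-- The finite embedding problem given by surjections of abstract groups, the finite groups being
equipped with the discrete topology. -/
def EmbeddingProblem.ofFinite (A : ProfiniteGrp.{u}) {P Q : Type u} [Group P] [Finite P] [Group Q]
    [Finite Q] (φ : A →* Q) (hopen : IsOpen (φ.ker : Set A)) (hφ : Function.Surjective φ)
    (α : P →* Q) (hα : Function.Surjective α) : EmbeddingProblem A :=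
  letI : TopologicalSpace P := ⊥
  letI : TopologicalSpace Q := ⊥
  haveI : DiscreteTopology P := ⟨rfl⟩
  haveI : DiscreteTopology Q := ⟨rfl⟩
  { Γ := ProfiniteGrp.of P
    G := ProfiniteGrp.of Q
    φ := ⟨φ, continuous_of_isOpen_ker φ hopen⟩
    α := ⟨α, continuous_of_discreteTopology⟩
    φ_surjective := hφ
    α_surjective := hα }

/-- A projective group lifts every surjection onto a finite quotient of a finite group. -/
theorem IsProjective.exists_lift {A : ProfiniteGrp.{u}} (hA : IsProjective A) {P Q : Type u}
    [Group P] [Finite P] [Group Q] [Finite Q] (φ : A →* Q) (hopen : IsOpen (φ.ker : Set A))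
    (hφ : Function.Surjective φ) (α : P →* Q) (hα : Function.Surjective α) :
    ∃ ψ : A →* P, IsOpen (ψ.ker : Set A) ∧ ∀ x, α (ψ x) = φ x := by
  obtain ⟨ψ, hψ⟩ := hA (.ofFinite A φ hopen hφ α hα)
  let : TopologicalSpace P := ⊥
  have : DiscreteTopology P := ⟨rfl⟩
  exact ⟨ψ.toMonoidHom, isOpen_ker_of_continuous (P := P) ψ.toMonoidHom ψ.continuous, hψ⟩

/-- Every nontrivial finite split embedding problem for `A` whose kernel is a minimal normal
subgroup contained in the radical has at least `m` proper solutions. -/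
def HasManySplitSolutions (A : ProfiniteGrp.{u}) (m : Cardinal.{u}) : Prop :=
  ∀ E : EmbeddingProblem A, E.IsFinite → E.IsNontrivial → E.IsSplit →
      IsMinimalNormal E.kernel → E.kernel ≤ normalRadical E.Γ →
      m ≤ Cardinal.mk E.properSolutions

/-- The case of abstract finite groups, where all normal subgroups are closed. -/
theorem HasManySplitSolutions.le_mk {A : ProfiniteGrp.{u}} {m : Cardinal.{u}}
    (hA : HasManySplitSolutions A m) {P Q : Type u} [Group P] [Finite P] [Group Q]
    [Finite Q] (φ : A →* Q) (hopen : IsOpen (φ.ker : Set A)) (hφ : Function.Surjective φ)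
    (α : P →* Q) (s : Q →* P) (hs : ∀ q, α (s q) = q) (hmin : IsMinimalNormal α.ker)
    (hrad : ∀ T : Subgroup P, Maximal (fun K : Subgroup P => K.Normal ∧ K ≠ ⊤) T → α.ker ≤ T) :
    m ≤ #{ψ : A →* P | IsOpen (ψ.ker : Set A) ∧ Function.Surjective ψ ∧ ∀ x, α (ψ x) = φ x} := by
  let tP : TopologicalSpace P := ⊥
  let tQ : TopologicalSpace Q := ⊥
  have : DiscreteTopology P := ⟨rfl⟩
  have : DiscreteTopology Q := ⟨rfl⟩
  let E : EmbeddingProblem A := .ofFinite A φ hopen hφ α (fun q => ⟨s q, hs q⟩)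
  refine (hA E (inferInstanceAs (Finite P)) hmin.1.2 ⟨⟨s, continuous_of_discreteTopology (α := Q)⟩, hs⟩
    hmin ?_).trans ?_
  · refine le_sInf fun T hT => hrad T ⟨⟨hT.1.1, hT.1.2.2⟩, fun K hK => hT.2 ⟨hK.1, ?_, hK.2⟩⟩
    exact isClosed_discrete (α := P) _
  · refine Cardinal.mk_le_of_injective (f := fun ψ => ⟨ψ.1.toMonoidHom,
      isOpen_ker_of_continuous (P := P) ψ.1.toMonoidHom ψ.1.continuous, ψ.2.2, ψ.2.1⟩) ?_
    intro ψ χ h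
    refine Subtype.ext (ContinuousMonoidHom.ext fun x => ?_)
    exact DFunLike.congr_fun (congrArg Subtype.val h) x

/-- If a normal subgroup `D` is not contained in a maximal normal subgroup `T` and `D` is minimal
normal, then the group is the direct product of `D` and `T`. -/
theorem inf_eq_bot_and_sup_eq_top_of_not_le {P : Type u} [Group P] {D T : Subgroup P}
    (hD : IsMinimalNormal D)
    (hT : Maximal (fun K : Subgroup P => K.Normal ∧ K ≠ ⊤) T) (hDT : ¬ D ≤ T) :
    T ⊓ D = ⊥ ∧ T ⊔ D = ⊤ := by
  have := hD.1.1
  have := hT.1.1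
  constructor
  · by_contra h
    exact hDT ((hD.2 ⟨inferInstance, h⟩ inf_le_right).trans inf_le_left)
  · by_contra h
    exact hDT (le_sup_right.trans (hT.2 ⟨inferInstance, h⟩ le_sup_left))

/-- A finite embedding problem with minimal normal kernel `N` has a proper solution outside a given
set of fewer than `m` homomorphisms, unless `N` is central or a direct factor.

Given a weak solution `ψ₀`, the group `N ⋊ ψ₀(A)` maps onto `P` by multiplication, and proper
solutions of the split problem `N ⋊ ψ₀(A) → ψ₀(A)` induce pairwise distinct proper solutions of
the given one. The exceptional cases are those where `N` is not contained in the radical of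
`N ⋊ ψ₀(A)`. -/
theorem exists_proper_solution_notMem {A : ProfiniteGrp.{u}} {m : Cardinal.{u}}
    (hproj : IsProjective A) (hsol : HasManySplitSolutions A m) {P : Type u} [Group P] [Finite P]
    (N : Subgroup P) [hN : N.Normal] (hmin : IsMinimalNormal N) (Φ : A →* P ⧸ N)
    (hopen : IsOpen (Φ.ker : Set A)) (hΦ : Function.Surjective Φ) (bad : Set (A →* P))
    (hbad : #bad < m) :
    N ≤ Subgroup.center P ∨ (∃ C : Subgroup P, C.Normal ∧ C ⊓ N = ⊥ ∧ C ⊔ N = ⊤) ∨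
      ∃ ψ : A →* P, IsOpen (ψ.ker : Set A) ∧ Function.Surjective ψ ∧
        (∀ x, (ψ x : P ⧸ N) = Φ x) ∧ ψ ∉ bad := by
  obtain ⟨ψ₀, hψ₀, hψ₀Φ⟩ := hproj.exists_lift Φ hopen hΦ (QuotientGroup.mk' N)
    (QuotientGroup.mk'_surjective N)
  let Q : Subgroup P := ψ₀.range
  let S := N ⋊[(MulAut.conjNormal (H := N)).comp Q.subtype] Q
  let μ : S →* P := SemidirectProduct.lift N.subtype Q.subtype (fun q => by ext n; simp)
  have : Finite S := Finite.of_equiv _ (SemidirectProduct.equivProd).symm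
  let α : S →* Q := SemidirectProduct.rightHom
  have hμ : ∀ x : S, μ x = x.left * x.right := fun x => rfl
  have hker : ∀ x : S, x ∈ α.ker → μ x ∈ N := fun x hx => by
    have h1 : x.right = 1 := hx
    rw [hμ, h1]; simp
  have hinj : ∀ x : S, x ∈ α.ker → ∀ y : S, y ∈ α.ker → μ x = μ y → x = y := by
    intro x hx y hy hxy
    have h1 : x.right = 1 := hx
    have h2 : y.right = 1 := hy
    rw [hμ, hμ, h1, h2] at hxy
    exact SemidirectProduct.ext (Subtype.ext (by simpa using hxy)) (h1.trans h2.symm)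
  have hlift : ∀ n ∈ N, ∃ x : S, x ∈ α.ker ∧ μ x = n := fun n hn =>
    ⟨SemidirectProduct.inl ⟨n, hn⟩, rfl, by simp [hμ]⟩
  have hμsurj : Function.Surjective μ := by
    intro p
    obtain ⟨a, ha⟩ := hΦ p
    have h1 : p * (ψ₀ a)⁻¹ ∈ N := by
      have h2 : (QuotientGroup.mk' N) (ψ₀ a) = QuotientGroup.mk' N p := (hψ₀Φ a).trans ha
      rw [← QuotientGroup.ker_mk' N, MonoidHom.mem_ker, map_mul, map_inv, h2, mul_inv_cancel]
    exact ⟨⟨⟨_, h1⟩, ⟨ψ₀ a, a, rfl⟩⟩, by simp [hμ]⟩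
  have hminS : IsMinimalNormal α.ker := by
    refine ⟨⟨inferInstance, ?_⟩, fun T hT hTα => ?_⟩
    · obtain ⟨⟨n, hn⟩, hn1⟩ := Subgroup.ne_bot_iff_exists_ne_one.1 hmin.1.2
      obtain ⟨x, hx, hxn⟩ := hlift _ hn
      intro hbot
      rw [hbot, Subgroup.mem_bot] at hx
      exact hn1 (Subtype.ext (hxn.symm.trans (by rw [hx, map_one]; rfl)))
    · have hle : N ≤ T.map μ := hmin.2 ⟨hT.1.map μ hμsurj, fun hbot => hT.2 ?_⟩ ?_
      · intro x hx
        obtain ⟨t, ht, htx⟩ := hle (hker x hx)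
        rwa [← hinj t (hTα ht) x hx htx]
      · refine (Subgroup.eq_bot_iff_forall T).2 fun t ht => hinj t (hTα ht) 1 (one_mem _) ?_
        rw [map_one, ← Subgroup.mem_bot, ← hbot]
        exact Subgroup.mem_map_of_mem μ ht
      · rintro _ ⟨t, ht, rfl⟩
        exact hker t (hTα ht)
  by_cases hrad : ∀ T : Subgroup S, Maximal (fun K : Subgroup S => K.Normal ∧ K ≠ ⊤) T → α.ker ≤ T
  · right; right
    have hmany := hsol.le_mk ψ₀.rangeRestrict (by rwa [MonoidHom.ker_rangeRestrict])
      ψ₀.rangeRestrict_surjective α SemidirectProduct.inr (fun q => rfl) hminS hrad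
    by_contra! hno
    refine (hmany.trans (Cardinal.mk_le_of_injective
      (f := fun ψ => (⟨μ.comp ψ.1, ?_⟩ : bad)) ?_)).not_gt hbad
    · refine hno _ (isOpen_ker_comp _ _ ψ.2.1) (hμsurj.comp ψ.2.2.1) fun x => ?_
      have h1 : (ψ.1 x).right = ψ₀.rangeRestrict x := ψ.2.2.2 x
      rw [← hψ₀Φ x, MonoidHom.comp_apply, hμ, h1]
      have h2 : (QuotientGroup.mk' N) ((ψ.1 x).left : P) = 1 := by
        rw [← MonoidHom.mem_ker, QuotientGroup.ker_mk']; exact (ψ.1 x).left.2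
      change QuotientGroup.mk' N _ = _
      rw [map_mul, h2, one_mul]; rfl
    · intro ψ χ h
      refine Subtype.ext (MonoidHom.ext fun x => ?_)
      have h1 : (ψ.1 x).right = (χ.1 x).right := (ψ.2.2.2 x).trans (χ.2.2.2 x).symm
      have h2 : μ (ψ.1 x) = μ (χ.1 x) := DFunLike.congr_fun (congrArg Subtype.val h) x
      rw [hμ, hμ, h1] at h2
      exact SemidirectProduct.ext (Subtype.ext (mul_right_cancel h2)) h1
  · push Not at hrad
    obtain ⟨T, hT, hTα⟩ := hrad
    obtain ⟨hinf, hsup⟩ := inf_eq_bot_and_sup_eq_top_of_not_le hminS hT hTα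
    have := hT.1.1
    -- `T` centralizes the kernel, and its image in `P` centralizes `N`
    have hcomm : ∀ t ∈ T, μ t ∈ Subgroup.centralizer (N : Set P) := by
      intro t ht
      rw [Subgroup.mem_centralizer_iff]
      intro n hn
      obtain ⟨x, hx, rfl⟩ := hlift n hn
      have := Subgroup.commute_of_normal_of_disjoint T α.ker inferInstance inferInstance
        (disjoint_iff.2 hinf) t x ht hx
      rw [← map_mul, ← map_mul, this.eq]
    have hdecomp : ∀ p : P, ∃ c ∈ Subgroup.centralizer (N : Set P), ∃ n ∈ N, c * n = p := by
      intro p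
      obtain ⟨x, rfl⟩ := hμsurj p
      obtain ⟨t, ht, d, hd, rfl⟩ := Subgroup.mem_sup_of_normal_right.1
        (hsup ▸ Subgroup.mem_top x : x ∈ T ⊔ α.ker)
      exact ⟨μ t, hcomm t ht, μ d, hker d hd, (map_mul μ t d).symm⟩
    by_cases hab : Subgroup.centralizer (N : Set P) ⊓ N = ⊥
    · right; left
      refine ⟨Subgroup.centralizer N, inferInstance, hab, ?_⟩
      refine (Subgroup.eq_top_iff' _).2 fun p => ?_
      obtain ⟨c, hc, n, hn, rfl⟩ := hdecomp p
      exact mul_mem (Subgroup.mem_sup_left hc) (Subgroup.mem_sup_right hn)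
    · left
      have hle : N ≤ Subgroup.centralizer (N : Set P) :=
        (hmin.2 ⟨inferInstance, hab⟩ inf_le_right).trans inf_le_left
      intro n hn
      rw [Subgroup.mem_center_iff]
      intro p
      obtain ⟨c, hc, n', hn', rfl⟩ := hdecomp p
      have h1 := Subgroup.mem_centralizer_iff.1 hc n hn
      have h2 := Subgroup.mem_centralizer_iff.1 (hle hn') n hn
      rw [mul_assoc, ← h2, ← mul_assoc, ← h1, mul_assoc]

/-! ### Correspondences -/

section Correspondence

variable {A B : Type*} [Group A] [Group B]

/-- The elements of `A` related to `1` by a subgroup `R` of `A × B`. -/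
def leftKernel (R : Subgroup (A × B)) : Subgroup A := R.comap (MonoidHom.inl A B)

/-- The elements of `B` to which `1` is related by a subgroup `R` of `A × B`. -/
def rightKernel (R : Subgroup (A × B)) : Subgroup B := R.comap (MonoidHom.inr A B)

/-- The opposite relation of a subgroup of `A × B`. -/
def opposite (R : Subgroup (A × B)) : Subgroup (B × A) :=
  R.comap (MulEquiv.prodComm : B × A ≃* A × B).toMonoidHom

@[simp] theorem mem_leftKernel {R : Subgroup (A × B)} {a : A} : a ∈ leftKernel R ↔ (a, 1) ∈ R :=
  Iff.rfl

@[simp] theorem mem_rightKernel {R : Subgroup (A × B)} {b : B} : b ∈ rightKernel R ↔ (1, b) ∈ R :=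
  Iff.rfl

@[simp] theorem mem_opposite {R : Subgroup (A × B)} {x : B × A} : x ∈ opposite R ↔ x.swap ∈ R :=
  Iff.rfl

variable [TopologicalSpace A] [TopologicalSpace B]

/-- A closed subgroup of `A × B` projecting onto both factors. By Goursat's lemma it amounts to an
isomorphism between the quotients of `A` and `B` by its left and right kernels. -/
structure IsCorrespondence (R : Subgroup (A × B)) : Prop where
  isClosed : IsClosed (R : Set (A × B))
  exists_right : ∀ a, ∃ b, (a, b) ∈ R
  exists_left : ∀ b, ∃ a, (a, b) ∈ R

namespace IsCorrespondence

variable {R : Subgroup (A × B)}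

theorem opposite (hR : IsCorrespondence R) : IsCorrespondence (opposite R) :=
  ⟨hR.isClosed.preimage continuous_swap, hR.exists_left, hR.exists_right⟩

theorem normal_rightKernel (hR : IsCorrespondence R) : (rightKernel R).Normal := by
  refine ⟨fun l hl b => ?_⟩
  obtain ⟨a, hab⟩ := hR.exists_left b
  simpa using mul_mem (mul_mem hab (mem_rightKernel.1 hl)) (inv_mem hab)

theorem normal_leftKernel (hR : IsCorrespondence R) : (leftKernel R).Normal :=
  hR.opposite.normal_rightKernel

/-- A homomorphism `B → Q` killing the right kernel is transported to `A`. -/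
theorem exists_hom_left [IsTopologicalGroup A] [IsTopologicalGroup B] [CompactSpace A]
    [CompactSpace B] [T2Space A] (hR : IsCorrespondence R) {Q : Type*} [Group Q] [Finite Q]
    (g : B →* Q) (hg : IsOpen (g.ker : Set B)) (hRg : rightKernel R ≤ g.ker) :
    ∃ f : A →* Q, IsOpen (f.ker : Set A) ∧ ∀ a b, (a, b) ∈ R → f a = g b := by
  let π : R →* A := (MonoidHom.fst A B).comp R.subtype
  have hπ : Function.Surjective π := fun a => by
    obtain ⟨b, hab⟩ := hR.exists_right a
    exact ⟨⟨_, hab⟩, rfl⟩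
  let h : R →* Q := (g.comp (MonoidHom.snd A B)).comp R.subtype
  have hh : π.ker ≤ h.ker := by
    rintro ⟨⟨a, b⟩, hab⟩ (rfl : a = 1)
    exact hRg hab
  let f : A →* Q := π.liftOfSurjective hπ ⟨h, hh⟩
  have hf : ∀ a b, (a, b) ∈ R → f a = g b := fun a b hab =>
    π.liftOfRightInverse_comp_apply _ (Function.rightInverse_surjInv hπ) ⟨h, hh⟩ ⟨(a, b), hab⟩
  refine ⟨f, ?_, hf⟩
  have hclosed : IsClosed (f.ker : Set A) := by
    have himage : (f.ker : Set A) = Prod.fst '' ((R : Set (A × B)) ∩ Prod.snd ⁻¹' g.ker) := by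
      ext a
      constructor
      · intro ha
        obtain ⟨b, hab⟩ := hR.exists_right a
        exact ⟨(a, b), ⟨hab, (hf a b hab).symm.trans ha⟩, rfl⟩
      · rintro ⟨⟨a, b⟩, ⟨hab, hb⟩, rfl⟩
        exact (hf a b hab).trans hb
    rw [himage]
    exact ((hR.isClosed.inter ((Subgroup.isClosed_of_isOpen _ hg).preimage
      continuous_snd)).isCompact.image continuous_fst).isClosed
  exact Subgroup.isOpen_of_isClosed_of_finiteIndex _ hclosed

/-- A correspondence is refined by the condition `f a = g b` if `f` and `g` already agree on it
modulo the common image of its kernels. -/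
theorem inf_eqLocus [IsTopologicalGroup A] [IsTopologicalGroup B] (hR : IsCorrespondence R)
    {Q : Type*} [Group Q] (f : A →* Q) (g : B →* Q)
    (hf : IsOpen (f.ker : Set A)) (hg : IsOpen (g.ker : Set B))
    (hfg : ∀ a b, (a, b) ∈ R → (g b)⁻¹ * f a ∈ (rightKernel R).map g)
    (hker : (leftKernel R).map f = (rightKernel R).map g) :
    ∃ R' ≤ R, IsCorrespondence R' ∧ leftKernel R' = leftKernel R ⊓ f.ker ∧
      rightKernel R' = rightKernel R ⊓ g.ker := by
  let F : Subgroup (A × B) :=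
    (f.comp (MonoidHom.fst A B)).eqLocus (g.comp (MonoidHom.snd A B))
  have hF : ∀ {a b}, (a, b) ∈ F ↔ f a = g b := Iff.rfl
  have hFopen : IsOpen (F : Set (A × B)) :=
    Subgroup.isOpen_mono (H₁ := f.ker.prod g.ker)
      (fun x hx => hx.1.trans (Eq.symm hx.2)) (hf.prod hg)
  refine ⟨R ⊓ F, inf_le_left,
    ⟨hR.isClosed.inter (Subgroup.isClosed_of_isOpen _ hFopen), fun a => ?_, fun b => ?_⟩, ?_, ?_⟩
  · obtain ⟨b, hab⟩ := hR.exists_right a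
    obtain ⟨l, hl, hl'⟩ := hfg a b hab
    refine ⟨b * l, by simpa using mul_mem hab (mem_rightKernel.1 hl), hF.2 ?_⟩
    rw [map_mul, hl', mul_inv_cancel_left]
  · obtain ⟨a, hab⟩ := hR.exists_left b
    obtain ⟨k, hk, hk'⟩ := hker.symm ▸ hfg a b hab
    refine ⟨a * k⁻¹, by simpa using mul_mem hab (inv_mem (mem_leftKernel.1 hk)), hF.2 ?_⟩
    rw [map_mul, map_inv, hk', mul_inv_rev, inv_inv, mul_inv_cancel_left]
  · ext a
    refine and_congr Iff.rfl ?_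
    change f a = g 1 ↔ f a = 1
    rw [map_one]
  · ext b
    refine and_congr Iff.rfl ?_
    change f 1 = g b ↔ g b = 1
    rw [map_one, eq_comm]

end IsCorrespondence

end Correspondence

/-- `K` has fewer than `m` homomorphisms to any given finite group that kill it. -/
def IsSmallKernel {A : ProfiniteGrp.{u}} (K : Subgroup A) (m : Cardinal.{u}) : Prop :=
  ∀ (P : Type u) [Group P] [Finite P], #{ψ : A →* P | IsOpen (ψ.ker : Set A) ∧ K ≤ ψ.ker} < m

section MinimalStep

variable {A B : ProfiniteGrp.{u}} {R : Subgroup (A × B)}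

/-- The kernel of a homomorphism with open kernel, as an open normal subgroup. -/
def openKer {A : ProfiniteGrp.{u}} {P : Type*} [Group P] (f : A →* P)
    (hf : IsOpen (f.ker : Set A)) : OpenNormalSubgroup A :=
  { f.ker with isOpen' := hf, isNormal' := inferInstanceAs f.ker.Normal }

instance finite_quotient {A : ProfiniteGrp.{u}} (U : OpenNormalSubgroup A) :
    Finite (A ⧸ U.toSubgroup) :=
  Subgroup.quotient_finite_of_isOpen _ U.isOpen'

theorem isOpen_ker_mk' {A : ProfiniteGrp.{u}} (U : OpenNormalSubgroup A) :
    IsOpen ((QuotientGroup.mk' U.toSubgroup).ker : Set A) := by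
  rw [QuotientGroup.ker_mk']; exact U.isOpen'

/-- The refinement step when `L / (L ⊓ C)` is a direct factor `B / C` of `B / (L ⊓ C)`. -/
theorem IsCorrespondence.refine_of_direct_factor (hR : IsCorrespondence R)
    (C : OpenNormalSubgroup B)
    (hmin : ∀ T : Subgroup B, T.Normal → rightKernel R ⊓ C.toSubgroup ≤ T → T ≤ rightKernel R →
      T = rightKernel R ⊓ C.toSubgroup ∨ T = rightKernel R)
    (hC : C.toSubgroup ⊔ rightKernel R = ⊤) (f : A →* B ⧸ C.toSubgroup)
    (hf : IsOpen (f.ker : Set A)) (hsurj : Function.Surjective f) (hRf : ¬ leftKernel R ≤ f.ker) :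
    ∃ R' ≤ R, IsCorrespondence R' ∧ (∃ O : OpenNormalSubgroup A,
      leftKernel R' = leftKernel R ⊓ O.toSubgroup) ∧
      rightKernel R' = rightKernel R ⊓ C.toSubgroup := by
  have hL := hR.normal_rightKernel
  have hK := hR.normal_leftKernel
  let π := QuotientGroup.mk' C.toSubgroup
  have hπ : ∀ b, ∃ l ∈ rightKernel R, π l = π b := by
    intro b
    obtain ⟨c, hc, l, hl, rfl⟩ := Subgroup.mem_sup_of_normal_right.1
      (hC ▸ Subgroup.mem_top b : b ∈ C.toSubgroup ⊔ rightKernel R)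
    have h1 : π c = 1 := (QuotientGroup.eq_one_iff c).2 hc
    exact ⟨l, hl, by rw [map_mul, h1, one_mul]⟩
  have hLtop : (rightKernel R).map π = ⊤ := by
    refine (Subgroup.eq_top_iff' _).2 fun x => ?_
    obtain ⟨b, rfl⟩ := QuotientGroup.mk'_surjective _ x
    exact hπ b
  have hKtop : (leftKernel R).map f = ⊤ := by
    have hn : ((leftKernel R).map f).Normal := hK.map f hsurj
    have hle : rightKernel R ⊓ C.toSubgroup ≤ ((leftKernel R).map f).comap π ⊓ rightKernel R := by
      refine le_inf (fun b hb => ?_) inf_le_left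
      have h1 : π b = 1 := (QuotientGroup.eq_one_iff b).2 hb.2
      rw [Subgroup.mem_comap, h1]
      exact one_mem _
    rcases hmin _ inferInstance hle inf_le_right with h | h
    · refine absurd (fun k hk => ?_) hRf
      obtain ⟨b, hb⟩ := QuotientGroup.mk'_surjective _ (f k)
      obtain ⟨l, hl, hlb⟩ := hπ b
      have h1 : l ∈ ((leftKernel R).map f).comap π ⊓ rightKernel R :=
        ⟨⟨k, hk, (hlb.trans hb).symm⟩, hl⟩
      rw [h] at h1
      rw [MonoidHom.mem_ker, ← hb, ← hlb]
      exact (QuotientGroup.eq_one_iff l).2 h1.2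
    · refine top_le_iff.1 (hLtop ▸ Subgroup.map_le_iff_le_comap.2 ?_)
      exact h ▸ inf_le_left
  obtain ⟨R', hR'R, hR', hl, hr⟩ := hR.inf_eqLocus f π hf (isOpen_ker_mk' C)
    (fun a b _ => hLtop ▸ Subgroup.mem_top _) (hKtop.trans hLtop.symm)
  exact ⟨R', hR'R, hR', ⟨openKer f hf, hl⟩, by rw [hr, QuotientGroup.ker_mk']⟩

/-- The embedding step: a correspondence whose right kernel `L` is minimal normal over `L ⊓ U` can
be refined so that the right kernel becomes `L ⊓ U`. Direct factors have to be dealt with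
separately, by `hfactor`. -/
theorem IsCorrespondence.refine_of_minimal {m : Cardinal.{u}} (hproj : IsProjective A)
    (hsol : HasManySplitSolutions A m) (hR : IsCorrespondence R)
    (hsmall : IsSmallKernel (leftKernel R) m) (U : OpenNormalSubgroup B)
    (hU : ¬ rightKernel R ≤ U.toSubgroup)
    (hmin : ∀ T : Subgroup B, T.Normal → rightKernel R ⊓ U.toSubgroup ≤ T → T ≤ rightKernel R →
      T = rightKernel R ⊓ U.toSubgroup ∨ T = rightKernel R)
    (hfactor : ∀ C : OpenNormalSubgroup B,
      rightKernel R ⊓ C.toSubgroup = rightKernel R ⊓ U.toSubgroup →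
      C.toSubgroup ⊔ rightKernel R = ⊤ → ∃ f : A →* B ⧸ C.toSubgroup,
        IsOpen (f.ker : Set A) ∧ Function.Surjective f ∧ ¬ leftKernel R ≤ f.ker) :
    ∃ R' ≤ R, IsCorrespondence R' ∧ (∃ O : OpenNormalSubgroup A,
      leftKernel R' = leftKernel R ⊓ O.toSubgroup) ∧
      rightKernel R' = rightKernel R ⊓ U.toSubgroup := by
  have hL := hR.normal_rightKernel
  have hK := hR.normal_leftKernel
  have hdirect : ∀ C : OpenNormalSubgroup B,
      rightKernel R ⊓ C.toSubgroup = rightKernel R ⊓ U.toSubgroup →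
      C.toSubgroup ⊔ rightKernel R = ⊤ → ∃ R' ≤ R, IsCorrespondence R' ∧
        (∃ O : OpenNormalSubgroup A, leftKernel R' = leftKernel R ⊓ O.toSubgroup) ∧
        rightKernel R' = rightKernel R ⊓ U.toSubgroup := by
    intro C hCU hC
    obtain ⟨f, hf, hsurj, hRf⟩ := hfactor C hCU hC
    rw [← hCU] at hmin ⊢
    exact hR.refine_of_direct_factor C hmin hC f hf hsurj hRf
  let π := QuotientGroup.mk' U.toSubgroup
  have hπsurj : Function.Surjective π := QuotientGroup.mk'_surjective _
  have hπ1 : ∀ b, π b = 1 ↔ b ∈ U.toSubgroup := fun b => QuotientGroup.eq_one_iff b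
  let N : Subgroup (B ⧸ U.toSubgroup) := (rightKernel R).map π
  have hN : N.Normal := hL.map π hπsurj
  have hNmin : IsMinimalNormal N := by
    refine ⟨⟨hN, fun h => hU fun l hl => ?_⟩, fun T hT hTN => ?_⟩
    · rw [← hπ1, ← Subgroup.mem_bot, ← h]
      exact Subgroup.mem_map_of_mem π hl
    · have := hT.1
      have hle : rightKernel R ⊓ U.toSubgroup ≤ T.comap π ⊓ rightKernel R := by
        refine le_inf (fun b hb => ?_) inf_le_left
        rw [Subgroup.mem_comap, (hπ1 b).2 hb.2]
        exact one_mem _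
      rcases hmin _ inferInstance hle inf_le_right with h | h
      · refine absurd ((Subgroup.eq_bot_iff_forall T).2 fun t ht => ?_) hT.2
        obtain ⟨l, hl, rfl⟩ := hTN ht
        have h1 : l ∈ T.comap π ⊓ rightKernel R := ⟨ht, hl⟩
        rw [h] at h1
        exact (hπ1 l).2 h1.2
      · exact Subgroup.map_le_iff_le_comap.2 (h ▸ inf_le_left)
  let ρ : B ⧸ U.toSubgroup →* (B ⧸ U.toSubgroup) ⧸ N := QuotientGroup.mk' N
  have hρ1 : ∀ x, ρ x = 1 ↔ x ∈ N := fun x => QuotientGroup.eq_one_iff x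
  obtain ⟨Φ, hΦopen, hΦ⟩ := hR.exists_hom_left (ρ.comp π)
    (isOpen_ker_comp π ρ (isOpen_ker_mk' U))
    (fun l hl => (hρ1 _).2 (Subgroup.mem_map_of_mem π hl))
  have hΦsurj : Function.Surjective Φ := by
    intro x
    obtain ⟨y, rfl⟩ := QuotientGroup.mk'_surjective N x
    obtain ⟨b, rfl⟩ := hπsurj y
    obtain ⟨a, hab⟩ := hR.exists_left b
    exact ⟨a, hΦ a b hab⟩
  have hcompat : ∀ ψ : A →* B ⧸ U.toSubgroup, (∀ x, ρ (ψ x) = Φ x) →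
      ∀ a b, (a, b) ∈ R → (π b)⁻¹ * ψ a ∈ N := by
    intro ψ hψ a b hab
    rw [← hρ1, map_mul, map_inv, hψ, hΦ a b hab]
    exact inv_mul_cancel _
  -- a lift of `Φ` not killing the left kernel defines the refinement
  have hlift : ∀ ψ : A →* B ⧸ U.toSubgroup, IsOpen (ψ.ker : Set A) → (∀ x, ρ (ψ x) = Φ x) →
      ((leftKernel R).map ψ).Normal → ¬ leftKernel R ≤ ψ.ker → ∃ R' ≤ R, IsCorrespondence R' ∧
        (∃ O : OpenNormalSubgroup A, leftKernel R' = leftKernel R ⊓ O.toSubgroup) ∧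
        rightKernel R' = rightKernel R ⊓ U.toSubgroup := by
    intro ψ hψ hψΦ hnorm hker
    have hle : (leftKernel R).map ψ ≤ N := by
      rintro _ ⟨k, hk, rfl⟩
      simpa using hcompat ψ hψΦ k 1 hk
    have hge : N ≤ (leftKernel R).map ψ := hNmin.2
      ⟨hnorm, fun h => hker fun k hk => by
        rw [MonoidHom.mem_ker, ← Subgroup.mem_bot, ← h]
        exact Subgroup.mem_map_of_mem ψ hk⟩ hle
    obtain ⟨R', hR'R, hR', hl, hr⟩ := hR.inf_eqLocus ψ π hψ (isOpen_ker_mk' U)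
      (hcompat ψ hψΦ) (le_antisymm hle hge)
    exact ⟨R', hR'R, hR', ⟨openKer ψ hψ, hl⟩, by rw [hr, QuotientGroup.ker_mk']⟩
  rcases exists_proper_solution_notMem hproj hsol N hNmin Φ hΦopen hΦsurj _
    (hsmall (B ⧸ U.toSubgroup)) with hcen | ⟨C₀, hC₀, hinf, hsup⟩ | ⟨ψ, hψ, hψsurj, hψΦ, hbad⟩
  · obtain ⟨ψ, hψ, hψΦ⟩ := hproj.exists_lift Φ hΦopen hΦsurj ρ (QuotientGroup.mk'_surjective N)
    by_cases hker : leftKernel R ≤ ψ.ker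
    · -- `ψ` descends to `B`, and its agreement locus with `π` is a normal complement
      obtain ⟨χ, hχ, hχψ⟩ := hR.opposite.exists_hom_left ψ hψ hker
      have hχπ : ∀ b, (π b)⁻¹ * χ b ∈ N := by
        intro b
        obtain ⟨a, hab⟩ := hR.exists_left b
        rw [hχψ b a hab]
        exact hcompat ψ hψΦ a b hab
      have hχL : ∀ l ∈ rightKernel R, χ l = 1 := fun l hl => by
        rw [hχψ l 1 hl, map_one]
      refine hdirect { toSubgroup := χ.eqLocus π, isOpen' := ?_, isNormal' := ⟨?_⟩ } ?_ ?_
      · exact Subgroup.isOpen_mono (H₁ := χ.ker ⊓ U.toSubgroup)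
          (fun b hb => (Eq.trans hb.1 ((hπ1 b).2 hb.2).symm)) (hχ.inter U.isOpen')
      · intro b (hb : χ b = π b) x
        change χ _ = π _
        have h1 := Subgroup.mem_center_iff.1 (hcen (hχπ x))
        have h2 : χ x = π x * ((π x)⁻¹ * χ x) := (mul_inv_cancel_left _ _).symm
        rw [map_mul, map_mul, map_inv, map_mul, map_mul, map_inv, hb, h2, mul_inv_rev,
          mul_assoc (π x), ← h1 (π b)]
        group
      · ext b
        refine and_congr_right fun hb => ?_
        change χ b = π b ↔ _
        rw [hχL b hb, eq_comm, hπ1]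
        rfl
      · refine (Subgroup.eq_top_iff' _).2 fun b => ?_
        obtain ⟨l, hl, hlb⟩ := hχπ b
        have h1 : b * l ∈ χ.eqLocus π := by
          change χ _ = π _
          rw [map_mul, map_mul, hχL l hl, hlb, mul_one, mul_inv_cancel_left]
        have h2 := mul_mem (Subgroup.mem_sup_left h1 : b * l ∈ χ.eqLocus π ⊔ rightKernel R)
          (inv_mem (Subgroup.mem_sup_right hl))
        rwa [mul_inv_cancel_right] at h2
    · refine hlift ψ hψ hψΦ ⟨?_⟩ hker
      rintro _ ⟨k, hk, rfl⟩ x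
      have h1 : ψ k ∈ N := by simpa using hcompat ψ hψΦ k 1 hk
      rw [Subgroup.mem_center_iff.1 (hcen h1) x, mul_inv_cancel_right]
      exact Subgroup.mem_map_of_mem ψ hk
  · refine hdirect { toSubgroup := C₀.comap π, isOpen' := ?_, isNormal' := inferInstance } ?_ ?_
    · exact Subgroup.isOpen_mono (H₁ := U.toSubgroup)
        (fun b hb => by rw [Subgroup.mem_comap, (hπ1 b).2 hb]; exact one_mem _) U.isOpen'
    · ext b
      refine and_congr_right fun hb => ?_
      change π b ∈ C₀ ↔ b ∈ U.toSubgroup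
      rw [← hπ1, ← Subgroup.mem_bot, ← hinf]
      exact ⟨fun h => ⟨h, Subgroup.mem_map_of_mem π hb⟩, fun h => h.1⟩
    · refine (Subgroup.eq_top_iff' _).2 fun b => ?_
      obtain ⟨c, hc, n, ⟨l, hl, rfl⟩, hcl⟩ := Subgroup.mem_sup_of_normal_right.1
        (hsup ▸ Subgroup.mem_top (π b) : π b ∈ C₀ ⊔ N)
      have h1 : b * l⁻¹ ∈ C₀.comap π := by
        rw [Subgroup.mem_comap, map_mul, ← hcl, map_inv, mul_inv_cancel_right]
        exact hc
      have h2 := mul_mem (Subgroup.mem_sup_left h1 : b * l⁻¹ ∈ C₀.comap π ⊔ rightKernel R)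
        (Subgroup.mem_sup_right hl)
      rwa [inv_mul_cancel_right] at h2
  · exact hlift ψ hψ hψΦ (hK.map ψ hψsurj) fun h => hbad ⟨hψ, h⟩

end MinimalStep

/-! ### Counting homomorphisms to a finite group -/

/-- Homomorphisms with open kernel which agree on a generating set are equal. -/
theorem TopologicallyGenerates.hom_ext {A : ProfiniteGrp.{u}} {X : Set A}
    (hX : TopologicallyGenerates A X) {P : Type*} [Group P] {ψ χ : A →* P}
    (hψ : IsOpen (ψ.ker : Set A)) (hχ : IsOpen (χ.ker : Set A)) (h : ∀ x ∈ X, ψ x = χ x) :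
    ψ = χ := by
  have hopen : IsOpen (ψ.eqLocus χ : Set A) := Subgroup.isOpen_mono (H₁ := ψ.ker ⊓ χ.ker)
    (fun x hx => Eq.trans hx.1 (Eq.symm hx.2)) (hψ.inter hχ)
  have hle : (Subgroup.closure X).topologicalClosure ≤ ψ.eqLocus χ :=
    Subgroup.topologicalClosure_minimal _ ((Subgroup.closure_le _).2 h)
      (Subgroup.isClosed_of_isOpen _ hopen)
  ext x
  exact hle (hX.symm ▸ Subgroup.mem_top x)

/-- A homomorphism is determined by its finitely many nontrivial values on the generators. -/
theorem mk_hom_le_mk_finset {A : ProfiniteGrp.{u}} {X : Set A} (hX : TopologicallyGenerates A X)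
    (hX' : ConvergesToOne A X) (P : Type u) [Group P] [Finite P] :
    #{ψ : A →* P | IsOpen (ψ.ker : Set A)} ≤ #(Finset (X × P)) := by
  classical
  have hfin : ∀ ψ : {ψ : A →* P | IsOpen (ψ.ker : Set A)},
      {y : X × P | ψ.1 y.1 = y.2 ∧ y.2 ≠ 1}.Finite := by
    intro ψ
    refine Set.Finite.of_finite_image (f := fun y => (y.1 : A))
      ((hX' (openKer ψ.1 ψ.2)).subset ?_) ?_
    · rintro _ ⟨y, ⟨hy, hy1⟩, rfl⟩
      exact ⟨y.1.2, fun h => hy1 (hy.symm.trans h)⟩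
    · rintro ⟨x, p⟩ ⟨hx, -⟩ ⟨y, q⟩ ⟨hy, -⟩ hxy
      obtain rfl : x = y := Subtype.ext hxy
      exact Prod.ext rfl (hx.symm.trans hy)
  refine Cardinal.mk_le_of_injective (f := fun ψ => (hfin ψ).toFinset) fun ψ χ h => ?_
  have hmem : ∀ (x : X) (p : P), p ≠ 1 → (ψ.1 x = p ↔ χ.1 x = p) := by
    intro x p hp
    have := Finset.ext_iff.1 h (x, p)
    simpa [hp] using this
  refine Subtype.ext (hX.hom_ext ψ.2 χ.2 fun x hx => ?_)
  by_cases h1 : ψ.1 x = 1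
  · by_contra hne
    exact hne ((hmem ⟨x, hx⟩ _ fun h2 => hne (h1.trans h2.symm)).2 rfl)
  · exact ((hmem ⟨x, hx⟩ _ h1).1 rfl).symm

theorem mk_finset_prod_lt {X P : Type u} [Finite P] [Nonempty P] {m : Cardinal.{u}}
    (hm : ℵ₀ ≤ m) (hX : #X < m) : #(Finset (X × P)) < m := by
  rcases finite_or_infinite X with h | h
  · exact (Cardinal.lt_aleph0_of_finite _).trans_le hm
  · rw [Cardinal.mk_finset_of_infinite, Cardinal.mk_prod, Cardinal.lift_id, Cardinal.lift_id]
    exact Cardinal.mul_lt_of_lt hm hX ((Cardinal.lt_aleph0_of_finite P).trans_le hm)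

theorem TopologicallyGenerates.image {A B : ProfiniteGrp.{u}} {X : Set A}
    (hX : TopologicallyGenerates A X) (f : A →ₜ* B) (hf : Function.Surjective f) :
    TopologicallyGenerates B (f '' X) := by
  have hle : (Subgroup.closure X).topologicalClosure ≤
      ((Subgroup.closure (f '' X)).topologicalClosure).comap f.toMonoidHom := by
    refine Subgroup.topologicalClosure_minimal _ ((Subgroup.closure_le _).2 fun x hx => ?_) ?_
    · exact Subgroup.le_topologicalClosure _ (Subgroup.subset_closure ⟨x, hx, rfl⟩)
    · exact (Subgroup.isClosed_topologicalClosure _).preimage f.continuous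
  refine (Subgroup.eq_top_iff' _).2 fun b => ?_
  obtain ⟨a, rfl⟩ := hf b
  exact hle (hX.symm ▸ Subgroup.mem_top a)

theorem ConvergesToOne.image {A B : ProfiniteGrp.{u}} {X : Set A}
    (hX : ConvergesToOne A X) (f : A →ₜ* B) : ConvergesToOne B (f '' X) := by
  intro U
  let V : OpenNormalSubgroup A :=
    { U.toSubgroup.comap f.toMonoidHom with
      isOpen' := U.isOpen'.preimage f.continuous
      isNormal' := inferInstanceAs (U.toSubgroup.comap f.toMonoidHom).Normal }
  refine ((hX V).image f).subset ?_
  rintro _ ⟨⟨x, hx, rfl⟩, hxU⟩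
  exact ⟨x, ⟨hx, hxU⟩, rfl⟩

/-- The rank is attained once it is nonzero, as the infimum of the empty set is `0`. -/
theorem exists_generators_of_rank_ne_zero {A : ProfiniteGrp.{u}} (h : rank A ≠ 0) :
    ∃ X : Set A, TopologicallyGenerates A X ∧ ConvergesToOne A X ∧ #X = rank A := by
  refine csInf_mem (s := {c | ∃ X : Set A, TopologicallyGenerates A X ∧ ConvergesToOne A X ∧
    Cardinal.mk X = c}) (Set.nonempty_iff_ne_empty.2 fun hempty => h ?_)
  rw [rank, hempty, Cardinal.sInf_empty]

/-- A quotient of a group with a generating set converging to `1` has such a generating set whose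
cardinality is its rank. -/
theorem exists_generators_of_surjective {A B : ProfiniteGrp.{u}} {X : Set A}
    (hX : TopologicallyGenerates A X) (hX' : ConvergesToOne A X) (f : A →ₜ* B)
    (hf : Function.Surjective f) :
    ∃ Y : Set B, TopologicallyGenerates B Y ∧ ConvergesToOne B Y ∧ #Y = rank B :=
  csInf_mem (s := {c | ∃ Y : Set B, TopologicallyGenerates B Y ∧ ConvergesToOne B Y ∧
    Cardinal.mk Y = c}) ⟨_, f '' X, hX.image f hf, hX'.image f, rfl⟩

/-! ### Homogeneity -/

/-- The fibre product of two surjections is a correspondence. -/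
theorem isCorrespondence_fiberProduct {A B G : ProfiniteGrp.{u}} (φ : A →ₜ* G) (α : B →ₜ* G)
    (hφ : Function.Surjective φ) (hα : Function.Surjective α) :
    ∃ R : Subgroup (A × B), IsCorrespondence R ∧ ∀ a b, (a, b) ∈ R ↔ φ a = α b :=
  ⟨(φ.toMonoidHom.comp (MonoidHom.fst A B)).eqLocus (α.toMonoidHom.comp (MonoidHom.snd A B)),
    ⟨isClosed_eq (φ.continuous.comp continuous_fst) (α.continuous.comp continuous_snd),
      fun a => (hα (φ a)).imp fun _ h => h.symm, fun b => hφ (α b)⟩, fun _ _ => Iff.rfl⟩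

/-- A correspondence with trivial right kernel is the graph of a homomorphism. -/
theorem IsCorrespondence.exists_continuousMonoidHom {A B : ProfiniteGrp.{u}}
    {R : Subgroup (A × B)} (hR : IsCorrespondence R) (hker : rightKernel R = ⊥) :
    ∃ ψ : A →ₜ* B, Function.Surjective ψ ∧ ∀ a, (a, ψ a) ∈ R := by
  let π : R →* A := (MonoidHom.fst A B).comp R.subtype
  have hπ : Function.Bijective π := by
    refine ⟨(injective_iff_map_eq_one π).2 ?_, fun a => ?_⟩
    · rintro ⟨⟨a, b⟩, hab⟩ (rfl : a = 1)
      have hb : b ∈ rightKernel R := hab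
      rw [hker, Subgroup.mem_bot] at hb
      subst hb
      rfl
    · obtain ⟨b, hab⟩ := hR.exists_right a
      exact ⟨⟨_, hab⟩, rfl⟩
  let e : R ≃* A := MulEquiv.ofBijective π hπ
  have hcompact : CompactSpace R := isCompact_iff_compactSpace.1 hR.isClosed.isCompact
  have hcont : Continuous e := continuous_fst.comp continuous_subtype_val
  have hsymm : Continuous e.symm :=
    (Continuous.homeoOfEquivCompactToT2 (f := e.toEquiv) hcont).symm.continuous
  have he : ∀ a, ((e.symm a : A × B)).1 = a := fun a => e.apply_symm_apply a
  let ψ : A →* B := ((MonoidHom.snd A B).comp R.subtype).comp e.symm.toMonoidHom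
  have hψ : ∀ a, (a, ψ a) ∈ R := fun a => by
    have h1 : ((a, ψ a) : A × B) = e.symm a := Prod.ext (he a).symm rfl
    rw [h1]
    exact (e.symm a).2
  refine ⟨⟨ψ, continuous_snd.comp (continuous_subtype_val.comp hsymm)⟩, fun b => ?_, hψ⟩
  obtain ⟨a, hab⟩ := hR.exists_left b
  refine ⟨a, ?_⟩
  have h1 : (ψ a)⁻¹ * b ∈ rightKernel R := by
    simpa using mul_mem (inv_mem (hψ a)) hab
  rw [hker, Subgroup.mem_bot, inv_mul_eq_one] at h1
  exact h1

/-- The kernel of a surjection onto a group of rank less than `m` is small. -/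
theorem isSmallKernel_ker {A G : ProfiniteGrp.{u}} {m : Cardinal.{u}} (hm : ℵ₀ ≤ m)
    (φ : A →ₜ* G) (hφ : Function.Surjective φ) {Y : Set G} (hY : TopologicallyGenerates G Y)
    (hY' : ConvergesToOne G Y) (hYm : #Y < m) : IsSmallKernel φ.toMonoidHom.ker m := by
  intro P _ _
  obtain ⟨R, hR, hmem⟩ := isCorrespondence_fiberProduct φ (ContinuousMonoidHom.id G) hφ
    Function.surjective_id
  have hdesc : ∀ ψ : {ψ : A →* P | IsOpen (ψ.ker : Set A) ∧ φ.toMonoidHom.ker ≤ ψ.ker},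
      ∃ χ : G →* P, IsOpen (χ.ker : Set G) ∧ ∀ a, χ (φ a) = ψ.1 a := by
    intro ψ
    obtain ⟨χ, hχ, h⟩ := hR.opposite.exists_hom_left ψ.1 ψ.2.1
      (fun a ha => ψ.2.2 ((hmem a 1).1 ha))
    exact ⟨χ, hχ, fun a => h _ a ((hmem a _).2 rfl)⟩
  choose χ hχ hχψ using hdesc
  refine (Cardinal.mk_le_of_injective (f := fun ψ => (⟨χ ψ, hχ ψ⟩ :
    {χ : G →* P | IsOpen (χ.ker : Set G)})) fun ψ ψ' h => ?_).trans_lt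
    ((mk_hom_le_mk_finset hY hY' P).trans_lt (mk_finset_prod_lt hm hYm))
  refine Subtype.ext (MonoidHom.ext fun a => ?_)
  rw [← hχψ, ← hχψ]
  exact DFunLike.congr_fun (congrArg Subtype.val h) _

theorem isHomogeneous_of_hasManySplitSolutions {A : ProfiniteGrp.{u}} {m : Cardinal.{u}}
    (hrank : rank A = m) (hm : ℵ₀ ≤ m) (hproj : IsProjective A)
    (hsol : HasManySplitSolutions A m) : IsHomogeneous A := by
  intro E _ hG hfin hmin hrad
  obtain ⟨X, hX, hX', -⟩ := exists_generators_of_rank_ne_zero (A := A)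
    (hrank ▸ (aleph0_pos.trans_le hm).ne')
  obtain ⟨Y, hY, hY', hYG⟩ := exists_generators_of_surjective hX hX' E.φ E.φ_surjective
  obtain ⟨R, hR, hmem⟩ := isCorrespondence_fiberProduct E.φ E.α E.φ_surjective E.α_surjective
  have hleft : leftKernel R = E.φ.toMonoidHom.ker := by
    ext a
    exact (hmem a 1).trans (by rw [map_one]; rfl)
  have hright : rightKernel R = E.kernel := by
    ext b
    exact (hmem 1 b).trans (by rw [map_one]; exact eq_comm)
  have hsmall : IsSmallKernel (leftKernel R) m := by
    rw [hleft]
    exact isSmallKernel_ker hm E.φ E.φ_surjective hY hY' (by rw [hYG, ← hrank]; exact hG)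
  -- the kernel is finite, so an open normal subgroup meets it trivially
  obtain ⟨U, hU⟩ : ∃ U : OpenNormalSubgroup E.Γ, E.kernel ⊓ U.toSubgroup = ⊥ := by
    have hopen : IsOpen ((E.kernel : Set E.Γ) \ {1})ᶜ :=
      ((Set.toFinite (E.kernel : Set E.Γ)).subset Set.sdiff_subset).isClosed.isOpen_compl
    obtain ⟨U, hU⟩ := ProfiniteGrp.exist_openNormalSubgroup_sub_open_nhds_of_one hopen (by simp)
    refine ⟨U, (Subgroup.eq_bot_iff_forall _).2 fun x hx => ?_⟩
    by_contra hx1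
    exact hU hx.2 ⟨hx.1, hx1⟩
  have hUH : ¬ rightKernel R ≤ U.toSubgroup := by
    rw [hright]
    intro h
    exact hmin.1.2 (by rw [← hU, inf_eq_left.2 h])
  have hminU : ∀ T : Subgroup E.Γ, T.Normal → rightKernel R ⊓ U.toSubgroup ≤ T →
      T ≤ rightKernel R → T = rightKernel R ⊓ U.toSubgroup ∨ T = rightKernel R := by
    rw [hright, hU]
    intro T hT _ hTH
    by_cases hbot : T = ⊥
    · exact Or.inl hbot
    · exact Or.inr (le_antisymm hTH (hmin.2 ⟨hT, hbot⟩ hTH))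
  -- a complement `C` would be a maximal normal subgroup not containing the kernel
  have hfactor : ∀ C : OpenNormalSubgroup E.Γ,
      rightKernel R ⊓ C.toSubgroup = rightKernel R ⊓ U.toSubgroup →
      C.toSubgroup ⊔ rightKernel R = ⊤ → False := by
    rw [hright, hU]
    intro C hCH hC
    have hCnormal : C.toSubgroup.Normal := C.isNormal'
    have hmax : IsMaximalNormal E.Γ C.toSubgroup := by
      refine ⟨⟨hCnormal, Subgroup.isClosed_of_isOpen _ C.isOpen', fun h => hmin.1.2 ?_⟩,
        fun K hK hCK => ?_⟩
      · rw [← hCH, h, inf_top_eq]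
      · have hKn := hK.1
        have hHn := hmin.1.1
        have hKH : K ⊓ E.kernel = ⊥ := by
          by_contra hne
          have h1 : E.kernel ≤ K := (hmin.2 ⟨inferInstance, hne⟩ inf_le_right).trans inf_le_left
          exact hK.2.2 (top_le_iff.1 (hC ▸ sup_le hCK h1))
        intro k hk
        obtain ⟨c, hc, h, hh, rfl⟩ := Subgroup.mem_sup_of_normal_right.1
          (hC ▸ Subgroup.mem_top k : k ∈ C.toSubgroup ⊔ E.kernel)
        have h1 : h ∈ K ⊓ E.kernel := ⟨(Subgroup.mul_mem_cancel_left K (hCK hc)).1 hk, hh⟩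
        rw [hKH, Subgroup.mem_bot] at h1
        rwa [h1, mul_one]
    refine hmin.1.2 ?_
    rw [← hCH, eq_comm, inf_eq_left]
    exact hrad.trans (sInf_le hmax)
  obtain ⟨R', hR'R, hR', -, hr⟩ := hR.refine_of_minimal hproj hsol hsmall U hUH hminU
    (fun C hCH hC => (hfactor C hCH hC).elim)
  obtain ⟨ψ, hψ, hψR⟩ := hR'.exists_continuousMonoidHom (by rw [hr, hright, hU])
  exact ⟨ψ, fun x => ((hmem x (ψ x)).1 (hR'R (hψR x))).symm, hψ⟩

/-! ### Bases of free profinite groups -/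

/-- The family `x` is a basis of the profinite group `F`, converging to `1`: it generates `F`, it
converges to `1`, and every family in a finite group with finite support extends to a homomorphism
from `F` with open kernel. -/
structure IsFreeBasis {F : ProfiniteGrp.{u}} {I : Type u} (x : I → F) : Prop where
  generates : TopologicallyGenerates F (Set.range x)
  finite_notMem : ∀ U : OpenNormalSubgroup F, {i | x i ∉ U}.Finite
  exists_lift : ∀ (P : Type u) [Group P] [Finite P] (g : I → P), {i | g i ≠ 1}.Finite →
    ∃ f : F →* P, IsOpen (f.ker : Set F) ∧ ∀ i, f (x i) = g i

section FreeProfinite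

variable (I : Type u)

/-- The canonical map from the abstract free group to the free profinite group. -/
def toFreeProfinite : FreeGroup I →* freeProfinite I where
  toFun w := ⟨fun _ => QuotientGroup.mk w, fun _ _ _ => rfl⟩
  map_one' := rfl
  map_mul' _ _ := rfl

variable {I}

/-- The projection of the free profinite group to a member of its defining inverse system. -/
def freeProfiniteProj (K : CofiniteNormalSubgroup I) :
    freeProfinite I →* FreeGroup I ⧸ K.1.toSubgroup where
  toFun z := z.val K
  map_one' := rfl
  map_mul' _ _ := rfl

theorem isOpen_ker_freeProfiniteProj (K : CofiniteNormalSubgroup I) :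
    IsOpen ((freeProfiniteProj K).ker : Set (freeProfinite I)) := by
  have hd : DiscreteTopology ((freeDiagram I ⋙ forget₂ FiniteGrp ProfiniteGrp).obj K) := ⟨rfl⟩
  have hc : Continuous fun z : freeProfinite I => z.val K :=
    (continuous_apply K).comp continuous_subtype_val
  exact (isOpen_discrete ({1} : Set _)).preimage hc

theorem exists_le_of_finset (s : Finset (CofiniteNormalSubgroup I)) :
    ∃ K : CofiniteNormalSubgroup I, ∀ L ∈ s, K ≤ L := by
  classical
  induction s using Finset.induction_on with
  | empty =>
    exact ⟨⟨FiniteIndexNormalSubgroup.ofSubgroup ⊤, by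
      convert Set.finite_empty (α := I)
      exact Set.eq_empty_of_forall_notMem fun i hi => hi (Subgroup.mem_top _)⟩, by simp⟩
  | insert L s _ ih =>
    obtain ⟨K, hK⟩ := ih
    refine ⟨⟨K.1 ⊓ L.1, (K.2.union L.2).subset fun i hi => ?_⟩, fun L' hL' => ?_⟩
    · by_contra h
      rw [Set.mem_union, not_or] at h
      exact hi ⟨not_not.1 h.1, not_not.1 h.2⟩
    · rcases Finset.mem_insert.1 hL' with rfl | h
      · exact (inf_le_right : K.1 ⊓ L'.1 ≤ L'.1)
      · exact (inf_le_left : K.1 ⊓ L.1 ≤ K.1).trans (hK L' h)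

/-- The fibres of the projections form a basis of the topology. -/
theorem exists_freeProfiniteProj_fiber_subset {W : Set (freeProfinite I)} (hW : IsOpen W)
    {z : freeProfinite I} (hz : z ∈ W) :
    ∃ K : CofiniteNormalSubgroup I, ∀ y, freeProfiniteProj K y = freeProfiniteProj K z → y ∈ W := by
  obtain ⟨W', hW', rfl⟩ := isOpen_induced_iff.1 hW
  obtain ⟨s, u, hsu, hs⟩ := isOpen_pi_iff.1 hW' z.val hz
  obtain ⟨K, hK⟩ := exists_le_of_finset s
  refine ⟨K, fun y hy => hs fun L hL => ?_⟩
  have h1 : ∀ w : freeProfinite I, (freeDiagram I ⋙ forget₂ FiniteGrp ProfiniteGrp).map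
      (homOfLE (hK L hL)) (w.val K) = w.val L := fun w => w.2 (homOfLE (hK L hL))
  have h2 : y.val L = z.val L := by
    rw [← h1 y, ← h1 z]
    exact congrArg _ hy
  rw [h2]
  exact (hsu L hL).2

theorem isFreeBasis_toFreeProfinite :
    IsFreeBasis fun i : I => toFreeProfinite I (FreeGroup.of i) := by
  have hproj : ∀ (K : CofiniteNormalSubgroup I) (w : FreeGroup I),
      freeProfiniteProj K (toFreeProfinite I w) = QuotientGroup.mk w := fun _ _ => rfl
  refine ⟨?_, fun U => ?_, fun P _ _ g hg => ?_⟩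
  · refine (Subgroup.eq_top_iff' _).2 fun z => mem_closure_iff.2 fun W hW hz => ?_
    obtain ⟨K, hK⟩ := exists_freeProfiniteProj_fiber_subset hW hz
    obtain ⟨w, hw⟩ := QuotientGroup.mk_surjective (freeProfiniteProj K z)
    refine ⟨toFreeProfinite I w, hK _ ((hproj K w).trans hw), ?_⟩
    have hle : (⊤ : Subgroup (FreeGroup I)) ≤ (Subgroup.closure
        (Set.range fun i : I => toFreeProfinite I (FreeGroup.of i))).comap (toFreeProfinite I) := by
      rw [← FreeGroup.closure_range_of, Subgroup.closure_le]
      rintro _ ⟨i, rfl⟩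
      exact Subgroup.subset_closure ⟨i, rfl⟩
    exact hle (Subgroup.mem_top w)
  · obtain ⟨K, hK⟩ := exists_freeProfiniteProj_fiber_subset U.isOpen' (one_mem U.toSubgroup)
    refine K.2.subset fun i hi hiK => hi (hK _ ?_)
    rw [hproj, map_one]
    exact (QuotientGroup.eq_one_iff _).2 hiK
  · let h : FreeGroup I →* P := FreeGroup.lift g
    let K : CofiniteNormalSubgroup I := ⟨FiniteIndexNormalSubgroup.ofSubgroup h.ker,
      hg.subset fun i hi hgi => hi (by
        change h (FreeGroup.of i) = 1
        rw [FreeGroup.lift_apply_of, hgi])⟩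
    refine ⟨(QuotientGroup.kerLift h).comp (freeProfiniteProj K),
      isOpen_ker_comp _ _ (isOpen_ker_freeProfiniteProj K), fun i => ?_⟩
    exact FreeGroup.lift_apply_of

end FreeProfinite

/-! ### Intersections of few open normal subgroups -/

/-- `K` is the intersection of fewer than `m` open normal subgroups. -/
def IsInfOfFew {A : ProfiniteGrp.{u}} (K : Subgroup A) (m : Cardinal.{u}) : Prop :=
  ∃ s : Set (OpenNormalSubgroup A), #s < m ∧ K = ⨅ U : s, U.1.toSubgroup

theorem mk_sigma_lt {ι : Type u} {T : ι → Type u} [∀ i, Finite (T i)] {m : Cardinal.{u}}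
    (hm : ℵ₀ ≤ m) (hι : #ι < m) : #(Σ i, T i) < m := by
  rcases finite_or_infinite ι with h | h
  · exact (Cardinal.lt_aleph0_of_finite _).trans_le hm
  · refine lt_of_le_of_lt ?_ hι
    rw [Cardinal.mk_sigma]
    refine (Cardinal.sum_le_sum _ (fun _ => ℵ₀)
      fun i => (Cardinal.lt_aleph0_of_finite (T i)).le).trans ?_
    rw [Cardinal.sum_const', Cardinal.mul_aleph0_eq (Cardinal.aleph0_le_mk ι)]

theorem IsInfOfFew.inf {A : ProfiniteGrp.{u}} {K : Subgroup A} {m : Cardinal.{u}} (hm : ℵ₀ ≤ m)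
    (hK : IsInfOfFew K m) (O : OpenNormalSubgroup A) : IsInfOfFew (K ⊓ O.toSubgroup) m := by
  obtain ⟨s, hs, rfl⟩ := hK
  refine ⟨insert O s, (Cardinal.mk_insert_le).trans_lt
    (Cardinal.add_lt_of_lt hm hs (Cardinal.one_lt_aleph0.trans_le hm)), ?_⟩
  ext x
  simp [Subgroup.mem_iInf, and_comm]

/-- An open subgroup containing an intersection of open normal subgroups contains a finite
subintersection. -/
theorem exists_finset_iInf_le {A : ProfiniteGrp.{u}} (s : Set (OpenNormalSubgroup A))
    (V : Subgroup A) (hV : IsOpen (V : Set A)) (h : ⨅ U : s, U.1.toSubgroup ≤ V) :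
    ∃ t : Finset s, ⨅ U ∈ t, U.1.toSubgroup ≤ V := by
  obtain ⟨t, ht⟩ := hV.isClosed_compl.isCompact.elim_finite_subfamily_closed
    (fun U : s => (U.1.toSubgroup : Set A))
    (fun U => Subgroup.isClosed_of_isOpen _ U.1.isOpen') (by
      refine Set.eq_empty_of_forall_notMem fun x hx => hx.1 (h ?_)
      simpa [Subgroup.mem_iInf] using hx.2)
  refine ⟨t, fun x hx => ?_⟩
  by_contra hxV
  have : x ∈ (V : Set A)ᶜ ∩ ⋂ U ∈ t, (U.1.toSubgroup : Set A) :=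
    ⟨hxV, by simpa [Subgroup.mem_iInf] using hx⟩
  rw [ht] at this
  exact this

theorem finite_hom_of_isOpen {A : ProfiniteGrp.{u}} (M : Subgroup A) [M.Normal]
    (hM : IsOpen (M : Set A)) (P : Type*) [Group P] [Finite P] :
    Finite {ψ : A →* P // M ≤ ψ.ker} := by
  have : Finite (A ⧸ M) := Subgroup.quotient_finite_of_isOpen _ hM
  refine Finite.of_injective (β := (A ⧸ M) → P)
    (fun ψ => QuotientGroup.lift M ψ.1 ψ.2) fun ψ χ h => ?_
  refine Subtype.ext (MonoidHom.ext fun a => ?_)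
  exact congrFun h (QuotientGroup.mk a)

theorem IsInfOfFew.isSmallKernel {A : ProfiniteGrp.{u}} {K : Subgroup A} {m : Cardinal.{u}}
    (hm : ℵ₀ ≤ m) (hK : IsInfOfFew K m) : IsSmallKernel K m := by
  obtain ⟨s, hs, rfl⟩ := hK
  intro P _ _
  have hfin : ∀ t : Finset s, Finite {ψ : A →* P // ⨅ U ∈ t, U.1.toSubgroup ≤ ψ.ker} := by
    intro t
    have hn : (⨅ U ∈ t, U.1.toSubgroup : Subgroup A).Normal :=
      Subgroup.normal_iInf_normal fun U => Subgroup.normal_iInf_normal fun _ => U.1.isNormal'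
    refine finite_hom_of_isOpen _ ?_ P
    rw [Subgroup.coe_iInf]
    simp only [Subgroup.coe_iInf]
    exact isOpen_biInter_finset fun U _ => U.1.isOpen'
  have hex : ∀ ψ : {ψ : A →* P | IsOpen (ψ.ker : Set A) ∧ ⨅ U : s, U.1.toSubgroup ≤ ψ.ker},
      ∃ t : Finset s, ⨅ U ∈ t, U.1.toSubgroup ≤ ψ.1.ker := fun ψ =>
    exists_finset_iInf_le s _ ψ.2.1 ψ.2.2
  choose t ht using hex
  refine (Cardinal.mk_le_of_injective
    (β := Σ t : Finset s, {ψ : A →* P // ⨅ U ∈ t, U.1.toSubgroup ≤ ψ.ker})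
    (f := fun ψ => ⟨t ψ, ψ.1, ht ψ⟩) fun ψ χ h => ?_).trans_lt (mk_sigma_lt hm ?_)
  · exact Subtype.ext (congrArg (fun y => y.2.1) h)
  · rcases finite_or_infinite s with h | h
    · exact (Cardinal.lt_aleph0_of_finite _).trans_le hm
    · rwa [Cardinal.mk_finset_of_infinite]

/-- A group with at most `m` generators converging to `1` has at most `m` open normal subgroups:
each of them is the kernel of the action on its cosets. -/
theorem mk_openNormalSubgroup_le {A : ProfiniteGrp.{u}} {X : Set A}
    (hX : TopologicallyGenerates A X) (hX' : ConvergesToOne A X) {m : Cardinal.{u}}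
    (hm : ℵ₀ ≤ m) (hXm : #X ≤ m) : #(OpenNormalSubgroup A) ≤ m := by
  let T : ULift.{u} ℕ → Type u := fun n =>
    {ψ : A →* Equiv.Perm (ULift.{u} (Fin n.down)) | IsOpen (ψ.ker : Set A)}
  have hT : ∀ n, #(T n) ≤ m := fun n => Order.lt_succ_iff.1
    ((mk_hom_le_mk_finset hX hX' _).trans_lt (mk_finset_prod_lt
      (hm.trans (Order.le_succ m)) (Order.lt_succ_of_le hXm)))
  have hsurj : Function.Surjective fun y : Σ n, T n => openKer y.2.1 y.2.2 := by
    intro N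
    let e : A ⧸ N.toSubgroup ≃ ULift.{u} (Fin (Nat.card (A ⧸ N.toSubgroup))) :=
      (Finite.equivFin _).trans Equiv.ulift.symm
    let ψ : A →* Equiv.Perm (ULift.{u} (Fin (Nat.card (A ⧸ N.toSubgroup)))) :=
      e.permCongrHom.toMonoidHom.comp (MulAction.toPermHom A (A ⧸ N.toSubgroup))
    have hψ : ψ.ker = N.toSubgroup :=
      (MonoidHom.ker_mulEquiv_comp (MulAction.toPermHom A (A ⧸ N.toSubgroup)) e.permCongrHom).trans
        ((Subgroup.normalCore_eq_ker N.toSubgroup).symm.trans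
          (Subgroup.normalCore_eq_self N.toSubgroup))
    have hopen : IsOpen (ψ.ker : Set A) := by
      rw [hψ]
      exact N.isOpen'
    refine ⟨⟨⟨_⟩, ψ, hopen⟩, ?_⟩
    exact SetLike.ext fun a => SetLike.ext_iff.1 hψ a
  refine (Cardinal.mk_le_of_surjective hsurj).trans ?_
  rw [Cardinal.mk_sigma]
  refine (Cardinal.sum_le_sum _ (fun _ => m) hT).trans ?_
  rw [Cardinal.sum_const']
  exact Cardinal.mul_le_of_le hm (by simpa using hm) le_rfl

/-! ### Refining a correspondence -/

section Refinement

variable {A B : ProfiniteGrp.{u}}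

/-- `R'` is a correspondence contained in `R` whose kernels are cut out in those of `R` by open
normal subgroups. -/
structure IsRefinement (R R' : Subgroup (A × B)) : Prop where
  le : R' ≤ R
  isCorrespondence : IsCorrespondence R'
  left : ∃ O : OpenNormalSubgroup A, leftKernel R' = leftKernel R ⊓ O.toSubgroup
  right : ∃ O : OpenNormalSubgroup B, rightKernel R' = rightKernel R ⊓ O.toSubgroup

theorem IsRefinement.trans {R R' R'' : Subgroup (A × B)} (h : IsRefinement R R')
    (h' : IsRefinement R' R'') : IsRefinement R R'' := by
  obtain ⟨O, hO⟩ := h.left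
  obtain ⟨O', hO'⟩ := h'.left
  obtain ⟨V, hV⟩ := h.right
  obtain ⟨V', hV'⟩ := h'.right
  exact ⟨h'.le.trans h.le, h'.isCorrespondence,
    ⟨O ⊓ O', by rw [hO', hO, inf_assoc]; rfl⟩, ⟨V ⊓ V', by rw [hV', hV, inf_assoc]; rfl⟩⟩

theorem IsCorrespondence.isRefinement_refl {R : Subgroup (A × B)} (hR : IsCorrespondence R) :
    IsRefinement R R :=
  ⟨le_rfl, hR,
    ⟨{ (⊤ : Subgroup A) with
        isOpen' := isOpen_univ, isNormal' := inferInstanceAs (⊤ : Subgroup A).Normal },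
      inf_top_eq _ |>.symm⟩,
    ⟨{ (⊤ : Subgroup B) with
        isOpen' := isOpen_univ, isNormal' := inferInstanceAs (⊤ : Subgroup B).Normal },
      inf_top_eq _ |>.symm⟩⟩

/-- If `A` surjects onto large powers of a simple group `S`, then some surjection `A → S` does not
kill a given small kernel. -/
theorem exists_surjective_not_le_ker {m : Cardinal.{u}} (hm : ℵ₀ ≤ m) (S : Type u) [Group S]
    [TopologicalSpace S] [DiscreteTopology S] [Finite S] [IsSimpleGroup S]
    (hS : simpleRank S A = m) {K : Subgroup A} (hK : IsSmallKernel K m) :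
    ∃ f : A →* S, IsOpen (f.ker : Set A) ∧ Function.Surjective f ∧ ¬ K ≤ f.ker := by
  have hlt := hK S
  rw [← hS] at hlt
  have hne : {c : Cardinal.{u} | ∃ (ι : Type u) (f : A →ₜ* (ι → S)),
      Function.Surjective f ∧ #ι = c}.Nonempty := by
    refine Set.nonempty_iff_ne_empty.2 fun h => (aleph0_pos.trans_le hm).ne' ?_
    rw [← hS, simpleRank, h]
    exact csSup_empty
  obtain ⟨c, ⟨ι, F, hF, rfl⟩, hc⟩ := exists_lt_of_lt_csSup hne hlt
  let f : ι → A →* S := fun i => (Pi.evalMonoidHom (fun _ => S) i).comp F.toMonoidHom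
  have hfopen : ∀ i, IsOpen ((f i).ker : Set A) := fun i =>
    isOpen_ker_of_continuous (f i) ((continuous_apply i).comp F.continuous)
  have hfsurj : ∀ i, Function.Surjective (f i) := fun i =>
    (Function.surjective_eval i).comp hF
  by_contra! hno
  refine hc.not_ge (Cardinal.mk_le_of_injective
    (f := fun i => ⟨f i, hfopen i, hno (f i) (hfopen i) (hfsurj i)⟩) fun i j hij => ?_)
  by_contra hne
  classical
  obtain ⟨s, hs⟩ := exists_ne (1 : S)
  obtain ⟨a, ha⟩ := hF (Pi.mulSingle i s)
  have h1 : f i a = f j a := DFunLike.congr_fun (congrArg Subtype.val hij) a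
  have h2 : (Pi.mulSingle i s : ι → S) i = (Pi.mulSingle i s : ι → S) j := by
    rw [← ha]
    exact h1
  rw [Pi.mulSingle_eq_same, Pi.mulSingle_eq_of_ne (Ne.symm hne)] at h2
  exact hs h2

/-- A group is simple if it is `B / C` for a complement `C` of a normal subgroup `L` which is
minimal over `L ⊓ C`. -/
theorem isSimpleGroup_quotient_of_minimal {G : Type*} [Group G] {L C : Subgroup G} [hL : L.Normal]
    [hC : C.Normal] (hLC : ¬ L ≤ C) (hsup : C ⊔ L = ⊤)
    (hmin : ∀ T : Subgroup G, T.Normal → L ⊓ C ≤ T → T ≤ L → T = L ⊓ C ∨ T = L) :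
    IsSimpleGroup (G ⧸ C) := by
  have hmk : ∀ x, QuotientGroup.mk' C x = 1 ↔ x ∈ C := fun x => QuotientGroup.eq_one_iff x
  refine { exists_pair_ne := ?_, eq_bot_or_eq_top_of_normal := fun T hT => ?_ }
  · obtain ⟨l, -, hlC⟩ := SetLike.not_le_iff_exists.1 hLC
    exact ⟨QuotientGroup.mk' C l, 1, fun h => hlC ((hmk l).1 h)⟩
  · have hCT : C ≤ T.comap (QuotientGroup.mk' C) := fun c hc => by
      rw [Subgroup.mem_comap, (hmk c).2 hc]
      exact one_mem _
    rcases hmin (L ⊓ T.comap (QuotientGroup.mk' C)) inferInstance (inf_le_inf_left L hCT)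
      inf_le_left with h | h
    · left
      refine (Subgroup.eq_bot_iff_forall T).2 fun t ht => ?_
      obtain ⟨x, rfl⟩ := QuotientGroup.mk'_surjective C t
      obtain ⟨c, hc, l, hl, rfl⟩ := Subgroup.mem_sup_of_normal_right.1
        (hsup ▸ Subgroup.mem_top x : x ∈ C ⊔ L)
      have h1 : l ∈ L ⊓ T.comap (QuotientGroup.mk' C) :=
        ⟨hl, (Subgroup.mul_mem_cancel_left (T.comap (QuotientGroup.mk' C)) (hCT hc)).1 ht⟩
      rw [h] at h1
      exact (hmk _).2 (mul_mem hc h1.2)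
    · right
      have h1 : T.comap (QuotientGroup.mk' C) = ⊤ :=
        top_le_iff.1 (hsup ▸ sup_le hCT (inf_eq_left.1 h))
      refine (Subgroup.eq_top_iff' T).2 fun t => ?_
      obtain ⟨x, rfl⟩ := QuotientGroup.mk'_surjective C t
      exact (h1 ▸ Subgroup.mem_top x : x ∈ T.comap (QuotientGroup.mk' C))

/-- A normal subgroup `L` not contained in an open normal subgroup `V` has a maximal `B`-normal
subgroup among the proper ones containing `L ⊓ V`. -/
theorem exists_maximal_normal_between (L : Subgroup B) [L.Normal] (V : OpenNormalSubgroup B)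
    (hLV : ¬ L ≤ V.toSubgroup) :
    ∃ T : Subgroup B, T.Normal ∧ L ⊓ V.toSubgroup ≤ T ∧ T < L ∧
      ∀ T' : Subgroup B, T'.Normal → T ≤ T' → T' ≤ L → T' = T ∨ T' = L := by
  have hVfin : V.toSubgroup.FiniteIndex := Subgroup.finiteIndex_of_finite_quotient
  have hVn : V.toSubgroup.Normal := V.isNormal'
  have hindex : ∀ T : Subgroup B, L ⊓ V.toSubgroup ≤ T → ∀ M ≤ L, T.relIndex M ≠ 0 := by
    intro T hT M hM h
    have h1 := Subgroup.relIndex_dvd_of_le_left M hT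
    rw [h, zero_dvd_iff] at h1
    have h2 : (L ⊓ V.toSubgroup).relIndex M = V.toSubgroup.relIndex M := by
      rw [← Subgroup.inf_relIndex_right, inf_right_comm, inf_eq_right.2 hM, inf_comm,
        Subgroup.inf_relIndex_right]
    exact V.toSubgroup.isFiniteRelIndex_of_finiteIndex.relIndex_ne_zero (h2 ▸ h1)
  let 𝒯 : Set (Subgroup B) := {T | T.Normal ∧ L ⊓ V.toSubgroup ≤ T ∧ T < L}
  have hne : 𝒯.Nonempty := ⟨L ⊓ V.toSubgroup, inferInstance, le_rfl,
    lt_of_le_of_ne inf_le_left fun h => hLV (inf_eq_left.1 h)⟩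
  obtain ⟨T, ⟨hTn, hVT, hTL⟩, hTmin⟩ :=
    (measure fun T : Subgroup B => T.relIndex L).wf.has_min 𝒯 hne
  refine ⟨T, hTn, hVT, hTL, fun T' hT'n hTT' hT'L => or_iff_not_imp_right.2 fun hne' => ?_⟩
  have h1 : ¬ T'.relIndex L < T.relIndex L :=
    hTmin T' ⟨hT'n, hVT.trans hTT', lt_of_le_of_ne hT'L hne'⟩
  have h2 := Subgroup.relIndex_mul_relIndex T T' L hTT' hT'L
  have h3 := hindex T hVT T' hT'L
  have h4 := hindex T' (hVT.trans hTT') L le_rfl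
  have h5 : T.relIndex T' = 1 := by
    by_contra h6
    have h7 : 2 ≤ T.relIndex T' := by omega
    have : 2 * T'.relIndex L ≤ T.relIndex T' * T'.relIndex L := Nat.mul_le_mul_right _ h7
    omega
  exact le_antisymm (Subgroup.relIndex_eq_one.1 h5) hTT'

/-- If `A` is projective with many solutions of split problems and large simple ranks, the right
kernel of a correspondence can be pushed into any open normal subgroup, through a chain of minimal
steps: the index of `L ⊓ V` in the right kernel `L` drops at each of them. -/
theorem exists_refinement_rightKernel_le {m : Cardinal.{u}} (hm : ℵ₀ ≤ m)
    (hproj : IsProjective A) (hsol : HasManySplitSolutions A m)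
    (hsimple : ∀ (S : Type u) [Group S] [TopologicalSpace S] [DiscreteTopology S] [Finite S]
      [IsSimpleGroup S], simpleRank S A = m)
    (V : OpenNormalSubgroup B) (R : Subgroup (A × B)) (hR : IsCorrespondence R)
    (hsmall : IsInfOfFew (leftKernel R) m) :
    ∃ R', IsRefinement R R' ∧ rightKernel R' ≤ V.toSubgroup := by
  induction h : V.toSubgroup.relIndex (rightKernel R) using Nat.strong_induction_on
    generalizing R with
  | _ n ih =>
  have hL := hR.normal_rightKernel
  have hVn : V.toSubgroup.Normal := V.isNormal'
  have hVfin : V.toSubgroup.FiniteIndex := Subgroup.finiteIndex_of_finite_quotient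
  by_cases hLV : rightKernel R ≤ V.toSubgroup
  · exact ⟨R, hR.isRefinement_refl, hLV⟩
  obtain ⟨T, hTn, hVT, hTL, hmax⟩ := exists_maximal_normal_between (rightKernel R) V hLV
  let U : OpenNormalSubgroup B :=
    { toSubgroup := T ⊔ V.toSubgroup
      isOpen' := Subgroup.isOpen_mono le_sup_right V.isOpen'
      isNormal' := inferInstance }
  have hLU : rightKernel R ⊓ U.toSubgroup = T := by
    refine le_antisymm (fun x hx => ?_) (le_inf hTL.le le_sup_left)
    obtain ⟨t, ht, v, hv, rfl⟩ := Subgroup.mem_sup_of_normal_right.1 hx.2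
    exact mul_mem ht (hVT ⟨(Subgroup.mul_mem_cancel_left _ (hTL.le ht)).1 hx.1, hv⟩)
  have hLnU : ¬ rightKernel R ≤ U.toSubgroup := fun hle =>
    hTL.ne (by rw [← hLU, inf_eq_left.2 hle])
  have hsmall' := hsmall.isSmallKernel hm
  have hmin : ∀ T' : Subgroup B, T'.Normal → rightKernel R ⊓ U.toSubgroup ≤ T' →
      T' ≤ rightKernel R → T' = rightKernel R ⊓ U.toSubgroup ∨ T' = rightKernel R := by
    rw [hLU]
    exact hmax
  obtain ⟨R₁, hR₁R, hR₁, hO, hr⟩ := hR.refine_of_minimal hproj hsol hsmall' U hLnU hmin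
    fun C hCU hC => by
      have hCn : C.toSubgroup.Normal := C.isNormal'
      have hsimpleC : IsSimpleGroup (B ⧸ C.toSubgroup) :=
        isSimpleGroup_quotient_of_minimal (L := rightKernel R)
          (fun hle => hLnU (inf_eq_left.1 (hCU ▸ inf_eq_left.2 hle))) hC (by rwa [hCU])
      let _ : TopologicalSpace (B ⧸ C.toSubgroup) := ⊥
      have : DiscreteTopology (B ⧸ C.toSubgroup) := ⟨rfl⟩
      exact exists_surjective_not_le_ker hm _ (hsimple _) hsmall'
  have hrefine : IsRefinement R R₁ := ⟨hR₁R, hR₁, hO, U, hr⟩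
  have hlt : V.toSubgroup.relIndex (rightKernel R₁) < n := by
    rw [hr, hLU, ← h]
    have h1 := Subgroup.relIndex_mul_relIndex _ T (rightKernel R) hVT hTL.le
    rw [inf_comm, Subgroup.inf_relIndex_right] at h1
    have h2 : (V.toSubgroup ⊓ rightKernel R).relIndex T = V.toSubgroup.relIndex T := by
      rw [← Subgroup.inf_relIndex_right, inf_assoc, inf_eq_right.2 hTL.le,
        Subgroup.inf_relIndex_right]
    rw [h2] at h1
    have h3 : V.toSubgroup.relIndex T ≠ 0 :=
      V.toSubgroup.isFiniteRelIndex_of_finiteIndex.relIndex_ne_zero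
    have h4 : V.toSubgroup.relIndex (rightKernel R) ≠ 0 :=
      V.toSubgroup.isFiniteRelIndex_of_finiteIndex.relIndex_ne_zero
    have h5 : T.relIndex (rightKernel R) ≠ 1 := fun h6 =>
      hTL.not_ge (Subgroup.relIndex_eq_one.1 h6)
    have h6 : T.relIndex (rightKernel R) ≠ 0 := fun h7 => h4 (by rw [← h1, h7, mul_zero])
    have h7 : 2 ≤ T.relIndex (rightKernel R) := by omega
    have : V.toSubgroup.relIndex T * 2 ≤ V.toSubgroup.relIndex T * T.relIndex (rightKernel R) :=
      Nat.mul_le_mul_left _ h7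
    omega
  obtain ⟨O, hO⟩ := hO
  obtain ⟨R', hR', hR'V⟩ := ih _ hlt R₁ hR₁ (by rw [hO]; exact hsmall.inf hm O) rfl
  exact ⟨R', hrefine.trans hR', hR'V⟩

/-- All but fewer than `m` elements of a basis lie in an intersection of fewer than `m` open normal
subgroups. -/
theorem IsFreeBasis.mk_notMem_lt {I : Type u} {x : I → B} (hx : IsFreeBasis x)
    {m : Cardinal.{u}} (hm : ℵ₀ ≤ m) {L : Subgroup B} (hL : IsInfOfFew L m) :
    #{i | x i ∉ L} < m := by
  obtain ⟨s, hs, rfl⟩ := hL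
  have hfin : ∀ U : s, Finite {i | x i ∉ U.1} := fun U => hx.finite_notMem U.1
  have hex : ∀ i : {i | x i ∉ ⨅ U : s, U.1.toSubgroup}, ∃ U : s, x i ∉ U.1 := by
    intro i
    have := i.2
    simp only [Set.mem_ofPred_eq, Subgroup.mem_iInf, not_forall] at this
    exact this
  choose U hU using hex
  refine (Cardinal.mk_le_of_injective (β := Σ U : s, {i | x i ∉ U.1})
    (f := fun i => ⟨U i, i.1, hU i⟩) fun i j hij => ?_).trans_lt (mk_sigma_lt hm hs)
  exact Subtype.ext (congrArg (fun y => (y.2 : I)) hij)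

/-- If `B` has a basis of cardinality `m`, the left kernel of a correspondence can be pushed into
any open normal subgroup: the finitely many values needed are prescribed on basis elements lying in
the right kernel. -/
theorem exists_refinement_leftKernel_le {m : Cardinal.{u}} (hm : ℵ₀ ≤ m) {I : Type u}
    (hI : #I = m) {x : I → B} (hx : IsFreeBasis x) (U : OpenNormalSubgroup A)
    (R : Subgroup (A × B)) (hR : IsCorrespondence R) (hsmall : IsInfOfFew (rightKernel R) m) :
    ∃ R', IsRefinement R R' ∧ leftKernel R' ≤ U.toSubgroup := by
  classical
  have hK := hR.normal_leftKernel
  let π := QuotientGroup.mk' U.toSubgroup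
  have hπsurj : Function.Surjective π := QuotientGroup.mk'_surjective _
  let N : Subgroup (A ⧸ U.toSubgroup) := (leftKernel R).map π
  have hN : N.Normal := hK.map π hπsurj
  let ρ : A ⧸ U.toSubgroup →* (A ⧸ U.toSubgroup) ⧸ N := QuotientGroup.mk' N
  have hρ1 : ∀ y, ρ y = 1 ↔ y ∈ N := fun y => QuotientGroup.eq_one_iff y
  have hρsurj : Function.Surjective ρ := QuotientGroup.mk'_surjective N
  obtain ⟨Φ, hΦopen, hΦ⟩ := hR.opposite.exists_hom_left (ρ.comp π)
    (isOpen_ker_comp π ρ (isOpen_ker_mk' U))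
    (fun l hl => (hρ1 _).2 (Subgroup.mem_map_of_mem π hl))
  have hΦL : ∀ l ∈ rightKernel R, Φ l = 1 := fun l hl => by rw [hΦ l 1 hl, map_one]
  obtain ⟨e⟩ : Nonempty (N ↪ ({i | x i ∉ rightKernel R}ᶜ : Set I)) := by
    have h1 : m ≤ #{i | x i ∉ rightKernel R} + #({i | x i ∉ rightKernel R}ᶜ : Set I) := by
      rw [Cardinal.mk_sum_compl, hI]
    have h2 : ℵ₀ ≤ #({i | x i ∉ rightKernel R}ᶜ : Set I) := by
      by_contra! h
      exact h1.not_gt (Cardinal.add_lt_of_lt hm (hx.mk_notMem_lt hm hsmall) (h.trans_le hm))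
    exact (Cardinal.lt_aleph0_of_finite N).le.trans h2
  have heL : ∀ n, x (e n) ∈ rightKernel R := fun n => not_not.1 (e n).2
  -- the values on the basis: they lift `Φ`, take all values in `N` on the elements chosen by `e`,
  -- and are trivial wherever `Φ` is trivial outside of these
  have hg : ∀ i, ∃ y, ρ y = Φ (x i) ∧ (∀ n, (e n : I) = i → y = n) ∧
      (Φ (x i) = 1 → (∀ n, (e n : I) ≠ i) → y = 1) := by
    intro i
    by_cases hi : ∃ n, (e n : I) = i
    · obtain ⟨n, rfl⟩ := hi
      refine ⟨n, ?_, fun n' hn' => ?_, fun _ h => absurd rfl (h n)⟩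
      · rw [hΦL _ (heL n), hρ1]
        exact n.2
      · rw [e.injective (Subtype.ext hn')]
    · push Not at hi
      by_cases h1 : Φ (x i) = 1
      · exact ⟨1, by rw [h1, map_one], fun n hn => absurd hn (hi n), fun _ _ => rfl⟩
      · obtain ⟨y, hy⟩ := hρsurj (Φ (x i))
        exact ⟨y, hy, fun n hn => absurd hn (hi n), fun h => absurd h h1⟩
  choose g hgΦ hge hg1 using hg
  have hgfin : {i | g i ≠ 1}.Finite := by
    refine ((hx.finite_notMem (openKer Φ hΦopen)).union
      (Set.finite_range fun n => (e n : I))).subset fun i hi => ?_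
    by_contra hcon
    rw [Set.mem_union, not_or] at hcon
    exact hi (hg1 i (not_not.1 hcon.1) fun n hn => hcon.2 ⟨n, hn⟩)
  obtain ⟨f, hf, hfg⟩ := hx.exists_lift _ g hgfin
  have hρf : ρ.comp f = Φ := by
    refine hx.generates.hom_ext (isOpen_ker_comp f ρ hf) hΦopen ?_
    rintro _ ⟨i, rfl⟩
    rw [MonoidHom.comp_apply, hfg, hgΦ]
  have hfN : (rightKernel R).map f = N := by
    refine le_antisymm ?_ fun n hn => ?_
    · rintro _ ⟨l, hl, rfl⟩
      exact (hρ1 _).1 ((DFunLike.congr_fun hρf l).trans (hΦL l hl))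
    · exact ⟨x (e ⟨n, hn⟩), heL _, (hfg _).trans (hge _ ⟨n, hn⟩ rfl)⟩
  obtain ⟨R', hR'R, hR', hl, hr⟩ := hR.inf_eqLocus π f (isOpen_ker_mk' U) hf
    (fun a b hab => by
      rw [hfN, ← hρ1, map_mul, map_inv, inv_mul_eq_one]
      exact (DFunLike.congr_fun hρf b).trans (hΦ b a hab)) hfN.symm
  rw [QuotientGroup.ker_mk'] at hl
  exact ⟨R', ⟨hR'R, hR', ⟨U, hl⟩, openKer f hf, hr⟩, hl ▸ inf_le_right⟩

end Refinement

/-! ### The transfinite back-and-forth -/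

section BackAndForth

variable {A B : ProfiniteGrp.{u}}

theorem leftKernel_iInf {ι : Sort*} (R : ι → Subgroup (A × B)) :
    leftKernel (⨅ i, R i) = ⨅ i, leftKernel (R i) :=
  Subgroup.comap_iInf _ _

theorem rightKernel_iInf {ι : Sort*} (R : ι → Subgroup (A × B)) :
    rightKernel (⨅ i, R i) = ⨅ i, rightKernel (R i) :=
  Subgroup.comap_iInf _ _

/-- By compactness, the intersection of a chain of correspondences is a correspondence. -/
theorem isCorrespondence_iInf {ι : Type*} (R : ι → Subgroup (A × B))
    (hR : ∀ i, IsCorrespondence (R i)) (hchain : ∀ i j, R i ≤ R j ∨ R j ≤ R i) :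
    IsCorrespondence (⨅ i, R i) := by
  rcases isEmpty_or_nonempty ι with hι | hι
  · rw [iInf_of_empty]
    exact ⟨isClosed_univ, fun _ => ⟨1, trivial⟩, fun _ => ⟨1, trivial⟩⟩
  refine ⟨?_, fun a => ?_, fun b => ?_⟩
  · rw [Subgroup.coe_iInf]
    exact isClosed_iInter fun i => (hR i).isClosed
  · have hclosed : ∀ i, IsClosed {b | (a, b) ∈ R i} := fun i =>
      (hR i).isClosed.preimage (Continuous.prodMk_right a)
    obtain ⟨b, hb⟩ := IsCompact.nonempty_iInter_of_directed_nonempty_isCompact_isClosed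
      (fun i => {b | (a, b) ∈ R i}) (fun i j => (hchain i j).elim
        (fun h => ⟨i, subset_rfl, fun _ hb => h hb⟩) (fun h => ⟨j, fun _ hb => h hb, subset_rfl⟩))
      (fun i => (hR i).exists_right a) (fun i => (hclosed i).isCompact) hclosed
    exact ⟨b, Subgroup.mem_iInf.2 fun i => Set.mem_iInter.1 hb i⟩
  · have hclosed : ∀ i, IsClosed {a | (a, b) ∈ R i} := fun i =>
      (hR i).isClosed.preimage (Continuous.prodMk_left b)
    obtain ⟨a, ha⟩ := IsCompact.nonempty_iInter_of_directed_nonempty_isCompact_isClosed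
      (fun i => {a | (a, b) ∈ R i}) (fun i j => (hchain i j).elim
        (fun h => ⟨i, subset_rfl, fun _ hb => h hb⟩) (fun h => ⟨j, fun _ hb => h hb, subset_rfl⟩))
      (fun i => (hR i).exists_left b) (fun i => (hclosed i).isCompact) hclosed
    exact ⟨a, Subgroup.mem_iInf.2 fun i => Set.mem_iInter.1 ha i⟩

/-- Along a well-order, let each `K i` be cut out in the intersection of its predecessors by an
open normal subgroup. Then the intersection of an initial segment of cardinality less than `m` is
an intersection of fewer than `m` open normal subgroups. -/
theorem isInfOfFew_of_wellOrder {J : Type u} {r : J → J → Prop} [IsWellOrder J r]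
    {m : Cardinal.{u}} (K : J → Subgroup A) (j : J) (hj : #{i // r i j} < m)
    (hK : ∀ i, r i j → ∃ O : OpenNormalSubgroup A,
      K i = (⨅ k : {k // r k i}, K k.1) ⊓ O.toSubgroup) :
    IsInfOfFew (⨅ i : {i // r i j}, K i.1) m := by
  have hex : ∀ i : {i // r i j}, ∃ O : OpenNormalSubgroup A,
      K i = (⨅ k : {k // r k i}, K k.1) ⊓ O.toSubgroup := fun i => hK i.1 i.2
  choose O hO using hex
  refine ⟨Set.range O, Cardinal.mk_range_le.trans_lt hj, le_antisymm ?_ ?_⟩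
  · refine le_iInf ?_
    rintro ⟨_, i, rfl⟩
    exact (iInf_le _ i).trans ((hO i).le.trans inf_le_right)
  · refine le_iInf fun i => ?_
    obtain ⟨i, hi⟩ := i
    induction i using (IsWellFounded.wf (r := r)).induction with
    | _ i ih =>
    change _ ≤ K i
    rw [hO ⟨i, hi⟩]
    refine le_inf (le_iInf fun k => ih k.1 k.2 (_root_.trans k.2 hi)) ?_
    exact iInf_le_of_le ⟨O ⟨i, hi⟩, Set.mem_range_self _⟩ le_rfl

theorem eq_bot_of_forall_le (K : Subgroup A) (h : ∀ U : OpenNormalSubgroup A, K ≤ U.toSubgroup) :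
    K = ⊥ := by
  refine (Subgroup.eq_bot_iff_forall K).2 fun x hx => ?_
  by_contra hne
  obtain ⟨U, hU⟩ := ProfiniteGrp.exist_openNormalSubgroup_sub_open_nhds_of_one
    (isOpen_compl_singleton (x := x)) (Ne.symm hne)
  exact hU (h U hx) rfl

/-- Back-and-forth: if both kernels of a correspondence can be pushed into arbitrary open normal
subgroups, as long as they are intersections of fewer than `m` such subgroups, then the two groups
are isomorphic. -/
theorem nonempty_continuousMulEquiv {m : Cardinal.{u}}
    (hA : #(OpenNormalSubgroup A) ≤ m) (hB : #(OpenNormalSubgroup B) ≤ m) (hm : ℵ₀ ≤ m)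
    (hleft : ∀ (U : OpenNormalSubgroup A) (R : Subgroup (A × B)), IsCorrespondence R →
      IsInfOfFew (rightKernel R) m → ∃ R', IsRefinement R R' ∧ leftKernel R' ≤ U.toSubgroup)
    (hright : ∀ (V : OpenNormalSubgroup B) (R : Subgroup (A × B)), IsCorrespondence R →
      IsInfOfFew (leftKernel R) m → ∃ R', IsRefinement R R' ∧ rightKernel R' ≤ V.toSubgroup) :
    Nonempty (A ≃ₜ* B) := by
  let J := OpenNormalSubgroup A ⊕ OpenNormalSubgroup B
  have hJ : #J ≤ m := by
    rw [Cardinal.mk_sum, Cardinal.lift_id, Cardinal.lift_id]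
    exact Cardinal.add_le_of_le hm hA hB
  obtain ⟨r, hr, hord⟩ := Cardinal.exists_ord_eq J
  have hseg : ∀ j, #{i // r i j} < m := fun j => by
    refine lt_of_lt_of_le ?_ hJ
    rw [← Ordinal.card_typein (r := r) j, ← Cardinal.lt_ord, hord]
    exact Ordinal.typein_lt_type r j
  let good : Subgroup (A × B) → Prop := fun R =>
    IsCorrespondence R ∧ IsInfOfFew (leftKernel R) m ∧ IsInfOfFew (rightKernel R) m
  let meets : J → Subgroup (A × B) → Prop := fun j R =>
    Sum.elim (fun U : OpenNormalSubgroup A => leftKernel R ≤ U.toSubgroup)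
      (fun V : OpenNormalSubgroup B => rightKernel R ≤ V.toSubgroup) j
  have hstep : ∀ j R, ∃ R', good R → IsRefinement R R' ∧ meets j R' := by
    intro j R
    by_cases hR : good R
    · rcases j with U | V
      · obtain ⟨R', h⟩ := hleft U R hR.1 hR.2.2
        exact ⟨R', fun _ => h⟩
      · obtain ⟨R', h⟩ := hright V R hR.1 hR.2.1
        exact ⟨R', fun _ => h⟩
    · exact ⟨R, fun h => absurd h hR⟩
  choose step hstep using hstep
  -- `ℛ j` refines the intersection of its predecessors so as to meet the `j`-th requirement
  let ℛ : J → Subgroup (A × B) := hr.wf.fix fun j ih => step j (⨅ i : {i // r i j}, ih i.1 i.2)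
  have hℛ : ∀ j, ℛ j = step j (⨅ i : {i // r i j}, ℛ i.1) := fun j => hr.wf.fix_eq _ j
  have hgood : ∀ j, good (⨅ i : {i // r i j}, ℛ i.1) := by
    intro j
    induction j using hr.wf.induction with
    | _ j ih =>
    have href : ∀ i, r i j → IsRefinement (⨅ k : {k // r k i}, ℛ k.1) (ℛ i) := fun i hi => by
      rw [hℛ i]
      exact (hstep i _ (ih i hi)).1
    have hle : ∀ i, r i j → ∀ k, r k i → ℛ i ≤ ℛ k := fun i hi k hk =>
      (href i hi).le.trans (iInf_le (fun k : {k // r k i} => ℛ k.1) ⟨k, hk⟩)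
    refine ⟨isCorrespondence_iInf _ (fun i => (href i.1 i.2).isCorrespondence) fun i k => ?_, ?_, ?_⟩
    · rcases trichotomous_of r i.1 k.1 with h | h | h
      · exact Or.inr (hle k.1 k.2 i.1 h)
      · exact Or.inl (h ▸ le_rfl)
      · exact Or.inl (hle i.1 i.2 k.1 h)
    · rw [leftKernel_iInf]
      refine isInfOfFew_of_wellOrder (r := r) (fun i => leftKernel (ℛ i)) j (hseg j) fun i hi => ?_
      rw [← leftKernel_iInf]
      exact (href i hi).left
    · rw [rightKernel_iInf]
      refine isInfOfFew_of_wellOrder (r := r) (fun i => rightKernel (ℛ i)) j (hseg j) fun i hi => ?_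
      rw [← rightKernel_iInf]
      exact (href i hi).right
  have hall : ∀ j, IsRefinement (⨅ k : {k // r k j}, ℛ k.1) (ℛ j) ∧ meets j (ℛ j) := fun j => by
    rw [hℛ j]
    exact hstep j _ (hgood j)
  have hle : ∀ i k, r k i → ℛ i ≤ ℛ k := fun i k hk =>
    (hall i).1.le.trans (iInf_le (fun k : {k // r k i} => ℛ k.1) ⟨k, hk⟩)
  have hcorr : IsCorrespondence (⨅ j, ℛ j) := by
    refine isCorrespondence_iInf _ (fun i => (hall i).1.isCorrespondence) fun i k => ?_
    rcases trichotomous_of r i k with h | h | h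
    · exact Or.inr (hle k i h)
    · exact Or.inl (h ▸ le_rfl)
    · exact Or.inl (hle i k h)
  have hl : leftKernel (⨅ j, ℛ j) = ⊥ := eq_bot_of_forall_le _ fun U => by
    rw [leftKernel_iInf]
    exact (iInf_le _ (Sum.inl U)).trans (hall (Sum.inl U)).2
  have hr' : rightKernel (⨅ j, ℛ j) = ⊥ := eq_bot_of_forall_le _ fun V => by
    rw [rightKernel_iInf]
    exact (iInf_le _ (Sum.inr V)).trans (hall (Sum.inr V)).2
  obtain ⟨ψ, hψ, hψR⟩ := hcorr.exists_continuousMonoidHom hr'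
  have hinj : Function.Injective ψ := (injective_iff_map_eq_one ψ).2 fun a ha => by
    have h1 : a ∈ leftKernel (⨅ j, ℛ j) := by
      have := hψR a
      rwa [ha] at this
    rwa [hl, Subgroup.mem_bot] at h1
  let e : A ≃* B := MulEquiv.ofBijective ψ ⟨hinj, hψ⟩
  exact ⟨{ e with
    continuous_toFun := ψ.continuous
    continuous_invFun :=
      (Continuous.homeoOfEquivCompactToT2 (f := e.toEquiv) ψ.continuous).symm.continuous }⟩

end BackAndForth

theorem isFreeOfRank_of_hasManySplitSolutions {A : ProfiniteGrp.{u}} {m : Cardinal.{u}}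
    (hrank : rank A = m) (hm : ℵ₀ ≤ m) (hproj : IsProjective A)
    (hsol : HasManySplitSolutions A m)
    (hsimple : ∀ (S : Type u) [Group S] [TopologicalSpace S] [DiscreteTopology S] [Finite S]
      [IsSimpleGroup S], simpleRank S A = m) : IsFreeOfRank A m := by
  obtain ⟨X, hX, hX', hXm⟩ := exists_generators_of_rank_ne_zero (A := A)
    (hrank ▸ (aleph0_pos.trans_le hm).ne')
  refine ⟨m.out, Cardinal.mk_out m, ?_⟩
  have hbasis := isFreeBasis_toFreeProfinite (I := m.out)
  have hconv : ConvergesToOne (freeProfinite m.out)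
      (Set.range fun i : m.out => toFreeProfinite m.out (FreeGroup.of i)) := by
    intro U
    refine ((hbasis.finite_notMem U).image
      fun i => toFreeProfinite m.out (FreeGroup.of i)).subset ?_
    rintro _ ⟨⟨i, rfl⟩, hi⟩
    exact ⟨i, hi, rfl⟩
  exact nonempty_continuousMulEquiv
    (mk_openNormalSubgroup_le hX hX' hm (hXm.trans hrank).le)
    (mk_openNormalSubgroup_le hbasis.generates hconv hm
      (Cardinal.mk_range_le.trans (Cardinal.mk_out m).le)) hm
    (fun U R hR => exists_refinement_leftKernel_le hm (Cardinal.mk_out m) hbasis U R hR)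
    (fun V R hR => exists_refinement_rightKernel_le hm hproj hsol hsimple V R hR)

end HomogeneousProfinite

open HomogeneousProfinite
theorem mainTheorem6 (A : ProfiniteGrp.{u}) (m : Cardinal.{u}) (hrank : rank A = m)
    (hm : Cardinal.aleph0 ≤ m) (hproj : IsProjective A)
    (hsol : ∀ E : EmbeddingProblem A, E.IsFinite → E.IsNontrivial → E.IsSplit →
      IsMinimalNormal E.kernel → E.kernel ≤ normalRadical E.Γ →
      m ≤ Cardinal.mk E.properSolutions) :
    IsHomogeneous A ∧
      ((∀ (S : Type u) [Group S] [TopologicalSpace S] [DiscreteTopology S] [Finite S]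
        [IsSimpleGroup S], simpleRank S A = m) → IsFreeOfRank A m) :=
  ⟨isHomogeneous_of_hasManySplitSolutions hrank hm hproj hsol,
    isFreeOfRank_of_hasManySplitSolutions hrank hm hproj hsol⟩
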